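/- Let $n\in\mathbb N$ and let $F:\mathbb R^n\times\mathbb R^n\to\mathbb R$ satisfy: (F1) for every $R>0$, $F$ is bounded and uniformly continuous on $\mathbb R^n\times B_R$, where $B_R$ is the ball of radius $R$ centred at the origin; (F2) $\inf_{x\in\mathbb R^n}F(x,p)\to+\infty$ as $|p|\to+\infty$. A continuous function $u$ on $(0,+\infty)\times\mathbb R^n$ is a viscosity solution of $$\partial_t u+F(x,D_xu)=0\quad\text{in }(0,+\infty)\times\mathbb R^n \qquad (\ast)$$ if, for every $\varphi\in C^1((0,+\infty)\times\mathbb R^n)$ and every $(t,x)\in(0,+\infty)\times\mathbb R^n$: $\partial_t\varphi(t,x)+F(x,D_x\varphi(t,x))\le 0$ whenever $u-\varphi$ has a local maximum at $(t,x)$, and $\partial_t\varphi(t,x)+F(x,D_x\varphi(t,x))\ge 0$ whenever $u-\varphi$ has a local minimum at $(t,x)$. Then for every uniformly continuous $u_0:\mathbb R^n\to\mathbb R$ there exists a unique uniformly continuous function $u:[0,+\infty)\times\mathbb R^n\to\mathbb R$ with $u(0,\cdot)=u_0$ that is a viscosity solution of $(\ast)$. Moreover, if $u_0$ is Lipschitz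 continuous on $\mathbb R^n$, then $u$ is Lipschitz continuous on $[0,+\infty)\times\mathbb R^n$, with a Lipschitz constant depending only on $\|Du_0\|_\infty$ (the essential supremum of $|Du_0|$) and $F$; that is, there is a function $K$ depending only on $F$ such that, for every Lipschitz $u_0$, the corresponding solution $u$ is Lipschitz with constant $K(\|Du_0\|_\infty)$. -/

import Mathlib

open scoped NNReal ENNReal

namespace HJ

/-- Euclidean space `ℝⁿ`. -/
abbrev Euc (n : ℕ) : Type := EuclideanSpace ℝ (Fin n)

/-- The two standing conditions on a Hamiltonian `F : ℝⁿ × ℝⁿ → ℝ`: it is bounded and uniformly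
continuous on `ℝⁿ × B_R` for every `R > 0`, and `inf_x F(x,p) → +∞` as `|p| → +∞`.
(By the first condition, with `R > |p|`, the infimum is that of a set bounded below.) -/
structure IsAdmissible {n : ℕ} (F : Euc n × Euc n → ℝ) : Prop where
  bounded : ∀ R : ℝ, 0 < R →
    ∃ C : ℝ, ∀ z ∈ (Set.univ : Set (Euc n)) ×ˢ Metric.ball (0 : Euc n) R, |F z| ≤ C
  uniformContinuousOn : ∀ R : ℝ, 0 < R →
    UniformContinuousOn F ((Set.univ : Set (Euc n)) ×ˢ Metric.ball (0 : Euc n) R)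
  coercive : Filter.Tendsto (fun p : Euc n => ⨅ x : Euc n, F (x, p))
    (Bornology.cobounded (Euc n)) Filter.atTop

/-- The set `(0,+∞) × ℝⁿ` in `ℝ × ℝⁿ`. -/
def openHalf (n : ℕ) : Set (ℝ × Euc n) := Set.Ioi 0 ×ˢ Set.univ

/-- The value of `∂_t φ + F(x, D_x φ)` at the point `(t,x)`. -/
noncomputable def hjOperator {n : ℕ} (F : Euc n × Euc n → ℝ) (φ : ℝ × Euc n → ℝ)
    (t : ℝ) (x : Euc n) : ℝ :=
  deriv (fun s : ℝ => φ (s, x)) t + F (x, gradient (fun y : Euc n => φ (t, y)) x)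

/-- Viscosity subsolutions of `∂_t u + F(x, D_x u) = 0` in `(0,+∞) × ℝⁿ`.
The function `u` is given on `[0,+∞) × ℝⁿ`; as `t > 0`, a local maximum at `(t,x)` relative to
`[0,+∞) × ℝⁿ` is the same as one relative to `(0,+∞) × ℝⁿ`. -/
def IsViscositySubsolution {n : ℕ} (F : Euc n × Euc n → ℝ) (u : ℝ≥0 × Euc n → ℝ) : Prop :=
  ∀ φ : ℝ × Euc n → ℝ, ContDiffOn ℝ 1 φ (openHalf n) →
    ∀ (t : ℝ≥0) (x : Euc n), 0 < t →
      IsLocalMax (fun z : ℝ≥0 × Euc n => u z - φ ((z.1 : ℝ), z.2)) (t, x) →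
      hjOperator F φ t x ≤ 0

/-- Viscosity supersolutions of `∂_t u + F(x, D_x u) = 0` in `(0,+∞) × ℝⁿ`. -/
def IsViscositySupersolution {n : ℕ} (F : Euc n × Euc n → ℝ) (u : ℝ≥0 × Euc n → ℝ) : Prop :=
  ∀ φ : ℝ × Euc n → ℝ, ContDiffOn ℝ 1 φ (openHalf n) →
    ∀ (t : ℝ≥0) (x : Euc n), 0 < t →
      IsLocalMin (fun z : ℝ≥0 × Euc n => u z - φ ((z.1 : ℝ), z.2)) (t, x) →
      0 ≤ hjOperator F φ t x

/-- (Continuous) viscosity solutions of `∂_t u + F(x, D_x u) = 0` in `(0,+∞) × ℝⁿ`. -/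
structure IsViscositySolution {n : ℕ} (F : Euc n × Euc n → ℝ) (u : ℝ≥0 × Euc n → ℝ) : Prop where
  continuousOn : ContinuousOn u {z : ℝ≥0 × Euc n | 0 < z.1}
  subsolution : IsViscositySubsolution F u
  supersolution : IsViscositySupersolution F u

/-- `u` is a uniformly continuous function on `[0,+∞) × ℝⁿ` with `u(0,·) = u₀` that solves
`∂_t u + F(x, D_x u) = 0` in `(0,+∞) × ℝⁿ` in the viscosity sense. -/
structure IsUCSolution {n : ℕ} (F : Euc n × Euc n → ℝ) (u₀ : Euc n → ℝ)
    (u : ℝ≥0 × Euc n → ℝ) : Prop where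
  uniformContinuous : UniformContinuous u
  initial : ∀ x : Euc n, u (0, x) = u₀ x
  solution : IsViscositySolution F u

/-- `‖Du₀‖_∞`, the essential supremum over `ℝⁿ` of the norm of the derivative of `u₀`
(which exists almost everywhere when `u₀` is Lipschitz). -/
noncomputable def gradSupNorm {n : ℕ} (u₀ : Euc n → ℝ) : ℝ≥0∞ :=
  MeasureTheory.eLpNorm (fderiv ℝ u₀) ∞ MeasureTheory.volume

end HJ

namespace HJ

open Filter Topology Metric MeasureTheory

variable {n : ℕ}

/-! Everything rests on one comparison principle, `comparison`, between a subsolution `u` and a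
supersolution `v` read at times that differ by a fixed `h`. The variables are doubled with the
penalty `a (t-s-h)² + b |x-y|²`. The weight `a` is fixed first: it bounds the time slope at the
maximum, so the equation bounds `F` there and coercivity confines the spatial slope to a ball. On
that ball `F` is uniformly continuous, and `b` can then be taken as large as its modulus requires,
since the slope bound does not depend on `b`.

For `L`-Lipschitz `u₀`, the functions `u₀ ± C t` are barriers, where `C` bounds `|F|` on slopes of
norm at most `L`. Perron's method (`exists_solution_of_lipschitz`) gives a solution between them.
Comparing it with its own time translates shows that it is `C`-Lipschitz in time
(`abs_sub_le_mul_time`); this bounds `F(x, Du)` from above, so coercivity bounds `Du`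
(`sub_le_mul_space`). `lipschitzWith_gradSupNorm` expresses the resulting constant through
`‖Du₀‖_∞`.

Comparison also makes the solution map a sup-norm contraction (`IsUCSolution.le_add_const`). This
gives uniqueness, and existence for uniformly continuous data: solutions with Lipschitz data
approximating `u₀` converge uniformly, and viscosity solutions are stable under such limits. -/

/-! ### Test functions, the operator, and the symmetry `u ↦ -u`. -/

theorem isOpen_openHalf : IsOpen (openHalf n) := isOpen_Ioi.prod isOpen_univ

theorem mem_openHalf {t : ℝ} {x : Euc n} (ht : 0 < t) : (t, x) ∈ openHalf n := ⟨ht, trivial⟩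

theorem openHalf_mem_nhds {t : ℝ} {x : Euc n} (ht : 0 < t) : openHalf n ∈ 𝓝 (t, x) :=
  isOpen_openHalf.mem_nhds (mem_openHalf ht)

theorem differentiableAt_of_contDiffOn_openHalf {φ : ℝ × Euc n → ℝ}
    (hφ : ContDiffOn ℝ 1 φ (openHalf n)) {t : ℝ} {x : Euc n} (ht : 0 < t) :
    DifferentiableAt ℝ φ (t, x) :=
  (hφ.differentiableOn one_ne_zero).differentiableAt (openHalf_mem_nhds ht)

/-- The inclusion of `[0,+∞) × ℝⁿ` into `ℝ × ℝⁿ`. -/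
def incl (z : ℝ≥0 × Euc n) : ℝ × Euc n := ((z.1 : ℝ), z.2)

theorem continuous_incl : Continuous (incl : ℝ≥0 × Euc n → ℝ × Euc n) :=
  (NNReal.continuous_coe.comp continuous_fst).prodMk continuous_snd

theorem continuousAt_incl_comp {φ : ℝ × Euc n → ℝ} (hφ : ContDiffOn ℝ 1 φ (openHalf n))
    {z : ℝ≥0 × Euc n} (hz : 0 < z.1) : ContinuousAt (fun z => φ (incl z)) z :=
  ContinuousAt.comp (f := incl) (g := φ)
    (differentiableAt_of_contDiffOn_openHalf hφ (NNReal.coe_pos.2 hz)).continuousAt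
    continuous_incl.continuousAt

/-- Since `t > 0`, neighbourhoods in the half space are full neighbourhoods in `ℝ × ℝⁿ`, so
two-sided derivative tests apply to local extrema of `u - φ`. -/
theorem eventually_nhds_of_eventually_incl {P : ℝ × Euc n → Prop} {t : ℝ≥0} {x : Euc n}
    (ht : 0 < t) (h : ∀ᶠ z in 𝓝 (t, x), P (incl z)) : ∀ᶠ z in 𝓝 ((t : ℝ), x), P z := by
  have hc : Tendsto (fun z : ℝ × Euc n => (Real.toNNReal z.1, z.2)) (𝓝 ((t : ℝ), x))
      (𝓝 (t, x)) := by
    have : Continuous (fun z : ℝ × Euc n => (Real.toNNReal z.1, z.2)) := by fun_prop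
    simpa using this.tendsto ((t : ℝ), x)
  filter_upwards [hc.eventually h, openHalf_mem_nhds (NNReal.coe_pos.2 ht)] with z hz hz'
  have : incl (Real.toNNReal z.1, z.2) = z := by
    ext1
    · exact Real.coe_toNNReal _ (le_of_lt hz'.1)
    · rfl
  rwa [this] at hz

theorem hjOperator_eq {F : Euc n × Euc n → ℝ} {φ : ℝ × Euc n → ℝ} {t a : ℝ} {x p : Euc n}
    (ha : HasDerivAt (fun s => φ (s, x)) a t) (hp : HasGradientAt (fun y => φ (t, y)) p x) :
    hjOperator F φ t x = a + F (x, p) := by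
  rw [hjOperator, ha.deriv, hp.gradient]

theorem hasDerivAt_time {φ : ℝ × Euc n → ℝ} {t : ℝ} {x : Euc n}
    (h : DifferentiableAt ℝ φ (t, x)) :
    HasDerivAt (fun s => φ (s, x)) (fderiv ℝ φ (t, x) (1, 0)) t := by
  exact h.hasFDerivAt.comp_hasDerivAt t ((hasDerivAt_id t).prodMk (hasDerivAt_const t x))

/-- The spatial gradient as a linear image of the Fréchet derivative. -/
noncomputable def spaceGradient (l : ℝ × Euc n →L[ℝ] ℝ) : Euc n :=
  (InnerProductSpace.toDual ℝ (Euc n)).symm (l.comp (ContinuousLinearMap.inr ℝ ℝ (Euc n)))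

theorem continuous_spaceGradient : Continuous (spaceGradient (n := n)) := by
  unfold spaceGradient
  exact (LinearIsometryEquiv.continuous _).comp (continuous_id.clm_comp continuous_const)

theorem hasGradientAt_space {φ : ℝ × Euc n → ℝ} {t : ℝ} {x : Euc n}
    (h : DifferentiableAt ℝ φ (t, x)) :
    HasGradientAt (fun y => φ (t, y)) (spaceGradient (fderiv ℝ φ (t, x))) x := by
  have h1 : HasFDerivAt (fun y : Euc n => (t, y)) (ContinuousLinearMap.inr ℝ ℝ (Euc n)) x :=
    hasFDerivAt_prodMk_right t x
  rw [hasGradientAt_iff_hasFDerivAt, spaceGradient, LinearIsometryEquiv.apply_symm_apply]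
  exact h.hasFDerivAt.comp x h1

theorem hjOperator_eq_fderiv {F : Euc n × Euc n → ℝ} {φ : ℝ × Euc n → ℝ} {t : ℝ} {x : Euc n}
    (h : DifferentiableAt ℝ φ (t, x)) :
    hjOperator F φ t x = fderiv ℝ φ (t, x) (1, 0) + F (x, spaceGradient (fderiv ℝ φ (t, x))) :=
  hjOperator_eq (hasDerivAt_time h) (hasGradientAt_space h)

theorem hjOperator_congr {F : Euc n × Euc n → ℝ} {φ ψ : ℝ × Euc n → ℝ} {t : ℝ} {x : Euc n}
    (hφ : DifferentiableAt ℝ φ (t, x)) (hψ : DifferentiableAt ℝ ψ (t, x))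
    (h : fderiv ℝ φ (t, x) = fderiv ℝ ψ (t, x)) : hjOperator F φ t x = hjOperator F ψ t x := by
  rw [hjOperator_eq_fderiv hφ, hjOperator_eq_fderiv hψ, h]

theorem continuousOn_hjOperator {F : Euc n × Euc n → ℝ} (hF : Continuous F)
    {φ : ℝ × Euc n → ℝ} (hφ : ContDiffOn ℝ 1 φ (openHalf n)) :
    ContinuousOn (fun z : ℝ × Euc n => hjOperator F φ z.1 z.2) (openHalf n) := by
  have hd : ContinuousOn (fderiv ℝ φ) (openHalf n) :=
    hφ.continuousOn_fderiv_of_isOpen isOpen_openHalf le_rfl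
  have : ContinuousOn (fun z : ℝ × Euc n =>
      fderiv ℝ φ z (1, 0) + F (z.2, spaceGradient (fderiv ℝ φ z))) (openHalf n) :=
    (hd.clm_apply continuousOn_const).add (hF.comp_continuousOn
      (continuous_snd.continuousOn.prodMk (continuous_spaceGradient.comp_continuousOn hd)))
  refine this.congr fun z hz => ?_
  exact hjOperator_eq_fderiv (differentiableAt_of_contDiffOn_openHalf hφ hz.1)

theorem eventually_hjOperator_lt {F : Euc n × Euc n → ℝ} (hF : Continuous F)
    {φ : ℝ × Euc n → ℝ} (hφ : ContDiffOn ℝ 1 φ (openHalf n)) {t : ℝ≥0} {x : Euc n} (ht : 0 < t)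
    {c : ℝ} (hc : hjOperator F φ t x < c) :
    ∀ᶠ z : ℝ≥0 × Euc n in 𝓝 (t, x), hjOperator F φ z.1 z.2 < c := by
  have h1 := (continuousOn_hjOperator hF hφ).continuousAt (x := ((t : ℝ), x))
    (openHalf_mem_nhds (NNReal.coe_pos.2 ht))
  have h2 : ContinuousAt (fun z : ℝ≥0 × Euc n => hjOperator F φ (incl z).1 (incl z).2) (t, x) :=
    ContinuousAt.comp (f := incl) (g := fun z : ℝ × Euc n => hjOperator F φ z.1 z.2)
      (x := (t, x)) h1 continuous_incl.continuousAt
  exact h2.eventually_lt_const hc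

theorem eventually_lt_hjOperator {F : Euc n × Euc n → ℝ} (hF : Continuous F)
    {φ : ℝ × Euc n → ℝ} (hφ : ContDiffOn ℝ 1 φ (openHalf n)) {t : ℝ≥0} {x : Euc n} (ht : 0 < t)
    {c : ℝ} (hc : c < hjOperator F φ t x) :
    ∀ᶠ z : ℝ≥0 × Euc n in 𝓝 (t, x), c < hjOperator F φ z.1 z.2 := by
  have h1 := (continuousOn_hjOperator hF hφ).continuousAt (x := ((t : ℝ), x))
    (openHalf_mem_nhds (NNReal.coe_pos.2 ht))
  have h2 : ContinuousAt (fun z : ℝ≥0 × Euc n => hjOperator F φ (incl z).1 (incl z).2) (t, x) :=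
    ContinuousAt.comp (f := incl) (g := fun z : ℝ × Euc n => hjOperator F φ z.1 z.2)
      (x := (t, x)) h1 continuous_incl.continuousAt
  exact h2.eventually_const_lt hc

/-- Two test functions touching at an interior point give the same value of the operator. -/
theorem hjOperator_eq_of_isLocalMax {F : Euc n × Euc n → ℝ} {φ ψ : ℝ × Euc n → ℝ}
    (hφ : ContDiffOn ℝ 1 φ (openHalf n)) (hψ : ContDiffOn ℝ 1 ψ (openHalf n))
    {t : ℝ≥0} {x : Euc n} (ht : 0 < t)
    (h : IsLocalMax (fun z : ℝ≥0 × Euc n => φ (incl z) - ψ (incl z)) (t, x)) :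
    hjOperator F φ t x = hjOperator F ψ t x := by
  have ht' : (0 : ℝ) < t := NNReal.coe_pos.2 ht
  have h1 := differentiableAt_of_contDiffOn_openHalf hφ ht' (x := x)
  have h2 := differentiableAt_of_contDiffOn_openHalf hψ ht' (x := x)
  have h3 : IsLocalMax (fun z : ℝ × Euc n => φ z - ψ z) ((t : ℝ), x) :=
    eventually_nhds_of_eventually_incl (P := fun z => φ z - ψ z ≤ φ (t, x) - ψ (t, x)) ht h
  have h4 := h3.fderiv_eq_zero
  rw [fderiv_fun_sub h1 h2] at h4
  exact hjOperator_congr h1 h2 (sub_eq_zero.1 h4)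

/-- The Hamiltonian of the equation solved by `-u`. -/
def dualHamiltonian (F : Euc n × Euc n → ℝ) (z : Euc n × Euc n) : ℝ := -F (z.1, -z.2)

theorem dualHamiltonian_dualHamiltonian (F : Euc n × Euc n → ℝ) :
    dualHamiltonian (dualHamiltonian F) = F := by
  ext z; simp [dualHamiltonian]

theorem continuous_dualHamiltonian {F : Euc n × Euc n → ℝ} (hF : Continuous F) :
    Continuous (dualHamiltonian F) := by
  unfold dualHamiltonian; fun_prop

theorem hjOperator_neg (F : Euc n × Euc n → ℝ) (φ : ℝ × Euc n → ℝ) (t : ℝ) (x : Euc n) :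
    hjOperator F (fun z => -φ z) t x = -hjOperator (dualHamiltonian F) φ t x := by
  simp only [hjOperator, dualHamiltonian, gradient, deriv.fun_neg, fderiv_fun_neg, map_neg]
  ring

/-- Lets each argument be carried out for subsolutions only and transferred by changing sign. -/
theorem isViscositySupersolution_iff {F : Euc n × Euc n → ℝ} {v : ℝ≥0 × Euc n → ℝ} :
    IsViscositySupersolution F v ↔
      IsViscositySubsolution (dualHamiltonian F) (fun z => -v z) := by
  constructor
  · intro h φ hφ t x ht hm
    have := h (fun z => -φ z) hφ.neg t x ht (by
      have := hm.neg
      refine this.congr (.of_forall fun z => ?_)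
      ring)
    rw [hjOperator_neg] at this
    linarith
  · intro h φ hφ t x ht hm
    have := h (fun z => -φ z) hφ.neg t x ht (by
      have := hm.neg
      refine this.congr (.of_forall fun z => ?_)
      ring)
    rw [hjOperator_neg, dualHamiltonian_dualHamiltonian] at this
    linarith

/-- Moving from `x` along `-p`, `ψ` falls at rate `‖p‖²` while `g` can fall at rate at most `L ‖p‖`.
Touching from above forces `‖p‖² ≤ L ‖p‖`. -/
theorem norm_le_of_isLocalMax {g ψ : Euc n → ℝ} {L : ℝ≥0} (hg : LipschitzWith L g) {x p : Euc n}
    (hψ : HasGradientAt ψ p x) (h : IsLocalMax (fun y => g y - ψ y) x) : ‖p‖ ≤ L := by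
  have hline : HasDerivAt (fun s : ℝ => x - s • p) (-p) 0 := by
    simpa using ((hasDerivAt_id (0 : ℝ)).smul_const p).const_sub x
  have hd : HasDerivAt (fun s : ℝ => ψ (x - s • p)) (-(‖p‖ ^ 2)) 0 := by
    have h0 : HasFDerivAt ψ (InnerProductSpace.toDual ℝ (Euc n) p) (x - (0 : ℝ) • p) := by
      simpa using hψ.hasFDerivAt
    have h1 : HasDerivAt (fun s : ℝ => ψ (x - s • p))
        (InnerProductSpace.toDual ℝ (Euc n) p (-p)) 0 := h0.comp_hasDerivAt (0 : ℝ) hline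
    rwa [map_neg, InnerProductSpace.toDual_apply_apply, real_inner_self_eq_norm_sq] at h1
  have hd2 : HasDerivAt (fun s : ℝ => ψ (x - s • p) + s * (L * ‖p‖))
      (-(‖p‖ ^ 2) + 1 * (L * ‖p‖)) 0 := hd.add ((hasDerivAt_id (0 : ℝ)).mul_const _)
  have hmin : IsLocalMinOn (fun s : ℝ => ψ (x - s • p) + s * (L * ‖p‖)) (Set.Ici 0) 0 := by
    have ht : Tendsto (fun s : ℝ => x - s • p) (𝓝 0) (𝓝 x) := by
      simpa using hline.continuousAt.tendsto
    have := (ht.eventually h).filter_mono (nhdsWithin_le_nhds (s := Set.Ici 0))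
    filter_upwards [this, self_mem_nhdsWithin] with s hs hs0
    have hs0 : 0 ≤ s := hs0
    have h1 := hg.dist_le_mul x (x - s • p)
    rw [Real.dist_eq, dist_eq_norm, sub_sub_cancel, norm_smul, Real.norm_of_nonneg hs0] at h1
    have h2 := le_abs_self (g x - g (x - s • p))
    simp only [zero_smul, sub_zero, zero_mul, add_zero]
    have h3 : g (x - s • p) - ψ (x - s • p) ≤ g x - ψ x := hs
    nlinarith
  have hnn := hmin.hasFDerivWithinAt_nonneg (y := 1) hd2.hasFDerivAt.hasFDerivWithinAt (by
    have : segment ℝ (0 : ℝ) (0 + 1) ⊆ Set.Ici 0 := by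
      rw [zero_add, segment_eq_Icc zero_le_one]; exact Set.Icc_subset_Ici_self
    exact mem_posTangentConeAt_of_segment_subset this)
  have hnn' : 0 ≤ -(‖p‖ ^ 2) + 1 * (L * ‖p‖) := by simpa using hnn
  by_contra hlt
  push Not at hlt
  have : 0 ≤ (L : ℝ) := L.2
  nlinarith

/-! ### Consequences of admissibility. -/

namespace IsAdmissible

variable {F : Euc n × Euc n → ℝ}

theorem continuous (hF : IsAdmissible F) : Continuous F := by
  rw [continuous_iff_continuousAt]
  intro z
  have h := (hF.uniformContinuousOn (‖z.2‖ + 1) (by positivity)).continuousOn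
  refine h.continuousAt ((isOpen_univ.prod isOpen_ball).mem_nhds ⟨trivial, ?_⟩)
  simp

theorem exists_norm_lt (hF : IsAdmissible F) (M : ℝ) :
    ∃ R : ℝ, 0 < R ∧ ∀ x p, F (x, p) ≤ M → ‖p‖ < R := by
  have h := hF.coercive.eventually (eventually_gt_atTop M)
  rw [← comap_norm_atTop, (atTop_basis.comap _).eventually_iff] at h
  obtain ⟨R, -, hR⟩ := h
  refine ⟨max R 1, by positivity, fun x p hp => ?_⟩
  by_contra! hlt
  have h1 : M < ⨅ x : Euc n, F (x, p) := hR (le_trans (le_max_left _ _) hlt)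
  -- A real infimum lies below each value only if the family is bounded below; boundedness on a ball
  -- containing `p` ensures this.
  obtain ⟨C, hC⟩ := hF.bounded (‖p‖ + 1) (by positivity)
  have h2 : BddBelow (Set.range fun x : Euc n => F (x, p)) := by
    refine ⟨-C, ?_⟩
    rintro _ ⟨y, rfl⟩
    exact (abs_le.1 (hC (y, p) ⟨trivial, by simp⟩)).1
  exact absurd (h1.trans_le (ciInf_le h2 x)) (not_lt.2 hp)

theorem exists_abs_le (hF : IsAdmissible F) (L : ℝ≥0) :
    ∃ C : ℝ, 0 ≤ C ∧ ∀ x p, ‖p‖ ≤ L → |F (x, p)| ≤ C := by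
  obtain ⟨C, hC⟩ := hF.bounded (L + 1) (by positivity)
  refine ⟨C, (abs_nonneg _).trans (hC (0, 0) ⟨trivial, by simp; positivity⟩), fun x p hp => ?_⟩
  refine hC (x, p) ⟨trivial, ?_⟩
  rw [mem_ball_zero_iff]
  linarith

end IsAdmissible

/-! ### Comparison by doubling of variables. -/

theorem exists_forall_le_of_isBounded {Z : Type*} [PseudoMetricSpace Z] [ProperSpace Z]
    {f : Z → ℝ} (hf : UpperSemicontinuous f) (z₀ : Z)
    (hb : Bornology.IsBounded {z | f z₀ ≤ f z}) : ∃ z, f z₀ ≤ f z ∧ ∀ w, f w ≤ f z := by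
  have hc : IsCompact {z | f z₀ ≤ f z} :=
    isCompact_of_isClosed_isBounded (hf.isClosed_preimage (f z₀)) hb
  obtain ⟨z, hz, hmax⟩ := (hf.upperSemicontinuousOn _).exists_isMaxOn ⟨z₀, le_refl (f z₀)⟩ hc
  refine ⟨z, hz, fun w => ?_⟩
  by_cases hw : f z₀ ≤ f w
  · exact hmax hw
  · exact (not_le.1 hw).le.trans hz

theorem hasGradientAt_quadratic (b β c : ℝ) (x y : Euc n) :
    HasGradientAt (fun ξ : Euc n => b * ‖ξ - y‖ ^ 2 + β * ‖ξ‖ ^ 2 + c)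
      ((2 * b) • (x - y) + (2 * β) • x) x := by
  rw [hasGradientAt_iff_hasFDerivAt]
  have h1 := (((hasFDerivAt_id x).sub_const y).norm_sq).const_mul b
  have h2 := ((hasFDerivAt_id x).norm_sq).const_mul β
  refine ((h1.add h2).add_const c).congr_fderiv ?_
  ext v
  change b * (2 • inner ℝ (x - y) v) + β * (2 • inner ℝ x v) =
    inner ℝ ((2 * b) • (x - y) + (2 * β) • x) v
  rw [inner_add_left, real_inner_smul_left, real_inner_smul_left, nsmul_eq_mul, nsmul_eq_mul]
  push_cast
  ring

/-- In `lam (t + t²)` the linear part yields the strict gain `lam` in the inequality, and the square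
absorbs linear growth in time. The term in `β` only localises in space. -/
theorem doubling_max_sub {F : Euc n × Euc n → ℝ} {u : ℝ≥0 × Euc n → ℝ}
    (hsub : IsViscositySubsolution F u) {a b lam β τ c : ℝ} {t : ℝ≥0} {x y : Euc n} (ht : 0 < t)
    (hmax : ∀ (t' : ℝ≥0) (x' : Euc n),
      u (t', x') - (a * ((t' : ℝ) - τ) ^ 2 + b * ‖x' - y‖ ^ 2 + lam * (t' + (t' : ℝ) ^ 2)
        + β * ‖x'‖ ^ 2) ≤ c)
    (hc : c = u (t, x) - (a * ((t : ℝ) - τ) ^ 2 + b * ‖x - y‖ ^ 2 + lam * (t + (t : ℝ) ^ 2)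
        + β * ‖x‖ ^ 2)) :
    2 * a * (t - τ) + lam * (1 + 2 * t) + F (x, (2 * b) • (x - y) + (2 * β) • x) ≤ 0 := by
  set φ : ℝ × Euc n → ℝ := fun z => a * (z.1 - τ) ^ 2 + b * ‖z.2 - y‖ ^ 2
    + lam * (z.1 + z.1 ^ 2) + β * ‖z.2‖ ^ 2 with hφ
  have hsm : ContDiff ℝ 1 φ := by
    have h1 : ContDiff ℝ 1 (fun z : ℝ × Euc n => ‖z.2 - y‖ ^ 2) :=
      (contDiff_snd.sub contDiff_const).norm_sq ℝ
    have h2 : ContDiff ℝ 1 (fun z : ℝ × Euc n => ‖z.2‖ ^ 2) := contDiff_snd.norm_sq ℝ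
    rw [hφ]
    fun_prop
  have key := hsub φ hsm.contDiffOn t x ht
    (.of_forall fun z => (hmax z.1 z.2).trans_eq hc)
  have hd : HasDerivAt (fun s : ℝ => φ (s, x)) (2 * a * (t - τ) + lam * (1 + 2 * t)) t := by
    have h1 := (((hasDerivAt_id (t : ℝ)).sub_const τ).pow 2).const_mul a
    have h2 := ((hasDerivAt_id (t : ℝ)).add ((hasDerivAt_id (t : ℝ)).pow 2)).const_mul lam
    refine (((h1.add_const (b * ‖x - y‖ ^ 2)).add h2).add_const (β * ‖x‖ ^ 2)).congr_deriv ?_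
    simp only [id, Nat.cast_ofNat, Nat.reduceSub, pow_one]
    ring
  have hg : HasGradientAt (fun ξ : Euc n => φ (t, ξ)) ((2 * b) • (x - y) + (2 * β) • x) x := by
    convert hasGradientAt_quadratic b β (a * ((t : ℝ) - τ) ^ 2 + lam * (t + (t : ℝ) ^ 2)) x y
      using 1
    ext ξ
    simp only [hφ]
    ring
  rwa [hjOperator_eq hd hg] at key

theorem doubling_max_super {F : Euc n × Euc n → ℝ} {v : ℝ≥0 × Euc n → ℝ}
    (hsup : IsViscositySupersolution F v) {a b τ c : ℝ} {s : ℝ≥0} {x y : Euc n} (hs : 0 < s)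
    (hmax : ∀ (s' : ℝ≥0) (y' : Euc n),
      -v (s', y') - (a * ((s' : ℝ) - τ) ^ 2 + b * ‖y' - x‖ ^ 2) ≤ c)
    (hc : c = -v (s, y) - (a * ((s : ℝ) - τ) ^ 2 + b * ‖y - x‖ ^ 2)) :
    0 ≤ 2 * a * (τ - s) + F (y, (2 * b) • (x - y)) := by
  have := doubling_max_sub (isViscositySupersolution_iff.1 hsup) (a := a) (b := b) (lam := 0)
    (β := 0) (τ := τ) (c := c) (x := y) (y := x) hs
    (fun t' x' => by simpa using hmax t' x') (by simpa using hc)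
  have h2 : -((2 * b) • (y - x) + (2 * 0 : ℝ) • y) = (2 * b) • (x - y) := by
    rw [mul_zero, zero_smul, add_zero, ← smul_neg, neg_sub]
  simp only [dualHamiltonian, h2] at this
  linarith

/-- The bound on the penalisation terms at points where the penalised difference is nonnegative. -/
theorem penalty_bound {A lam a b t T r X D : ℝ} (hlam : 0 < lam)
    (ha : 1 ≤ a) (hb : 1 ≤ b)
    (hD : D ≤ 1 + A * (r + T + t))
    (hpen : a * T ^ 2 + b * r ^ 2 + lam * (t + t ^ 2) + X ≤ D) :
    lam * t + a * T ^ 2 / 2 + b * r ^ 2 / 2 + X ≤ 1 + A ^ 2 + A ^ 2 / lam := by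
  have h1 : A * r ≤ A ^ 2 / 2 + b * r ^ 2 / 2 := by nlinarith [sq_nonneg (A - r), sq_nonneg r]
  have h2 : A * T ≤ A ^ 2 / 2 + a * T ^ 2 / 2 := by nlinarith [sq_nonneg (A - T), sq_nonneg T]
  have h3 : A * t ≤ A ^ 2 / lam + lam * t ^ 2 := by
    have e : A ^ 2 / lam = lam * (A / lam) ^ 2 := by field_simp
    have e2 : A * t = lam * (A / lam * t) := by field_simp
    rw [e, e2, ← mul_add]
    exact mul_le_mul_of_nonneg_left
      (by nlinarith [sq_nonneg (A / lam - t), sq_nonneg (A / lam), sq_nonneg t]) hlam.le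
  nlinarith

/-- A bounded penalty `a d² / 2 ≤ C` forces `d` to be of order `a^(-1/2)`, hence small once `a` is
large. -/
theorem exists_one_le_mul_lt (A C σ : ℝ) (hC : 0 ≤ C) (hσ : 0 < σ) :
    ∃ a₀ : ℝ, 1 ≤ a₀ ∧ ∀ a d, a₀ ≤ a → 0 ≤ d → a * d ^ 2 / 2 ≤ C → A * d < σ := by
  refine ⟨1 + 2 * C * (A / σ) ^ 2, by nlinarith [mul_nonneg hC (sq_nonneg (A / σ))],
    fun a d ha hd h => ?_⟩
  by_contra! hlt
  have h0 : 0 < d := by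
    rcases hd.eq_or_lt with rfl | h
    · linarith
    · exact h
  have h1 : 1 ≤ A / σ * d := by rw [div_mul_eq_mul_div, le_div_iff₀ hσ]; linarith
  have h2 : 1 ≤ (A / σ * d) ^ 2 := one_le_pow₀ h1
  have h3 : (1 + 2 * C * (A / σ) ^ 2) * d ^ 2 ≤ 2 * C := by
    nlinarith [mul_le_mul_of_nonneg_right ha (sq_nonneg d)]
  nlinarith [mul_le_mul_of_nonneg_left h2 (mul_nonneg zero_le_two hC), pow_pos h0 2]

/-- Growth control on the difference of `u` and a time-shift of `v`. -/
def ShiftedGrowth (h : ℝ) (u v : ℝ≥0 × Euc n → ℝ) : Prop :=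
  ∀ δ : ℝ, 0 < δ → ∃ A : ℝ, 0 ≤ A ∧ ∀ (t s : ℝ≥0) (x y : Euc n),
    u (t, x) - v (s, y) ≤ δ + A * (‖x - y‖ + |(t : ℝ) - s - h| + min (t : ℝ) s)

/-- The doubled, penalised difference. -/
noncomputable def doubled (u v : ℝ≥0 × Euc n → ℝ) (h a b lam β : ℝ)
    (z : (ℝ≥0 × Euc n) × (ℝ≥0 × Euc n)) : ℝ :=
  u z.1 - v z.2 - (a * ((z.1.1 : ℝ) - z.2.1 - h) ^ 2 + b * ‖z.1.2 - z.2.2‖ ^ 2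
    + lam * (z.1.1 + (z.1.1 : ℝ) ^ 2) + β * ‖z.1.2‖ ^ 2)

theorem upperSemicontinuous_doubled {u v : ℝ≥0 × Euc n → ℝ} (hu : UpperSemicontinuous u)
    (hv : LowerSemicontinuous v) (h a b lam β : ℝ) :
    UpperSemicontinuous (doubled u v h a b lam β) := by
  have h1 : UpperSemicontinuous fun z : (ℝ≥0 × Euc n) × (ℝ≥0 × Euc n) => u z.1 :=
    fun z c hc => continuous_fst.continuousAt.eventually (hu z.1 c hc)
  have h2 : UpperSemicontinuous fun z : (ℝ≥0 × Euc n) × (ℝ≥0 × Euc n) => -v z.2 := by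
    intro z c hc
    have := hv z.2 (-c) (by linarith)
    filter_upwards [continuous_snd.continuousAt.eventually this] with w hw
    linarith
  have h3 : Continuous fun z : (ℝ≥0 × Euc n) × (ℝ≥0 × Euc n) =>
      -(a * ((z.1.1 : ℝ) - z.2.1 - h) ^ 2 + b * ‖z.1.2 - z.2.2‖ ^ 2
        + lam * (z.1.1 + (z.1.1 : ℝ) ^ 2) + β * ‖z.1.2‖ ^ 2) := by fun_prop
  have := (h1.add h2).add h3.upperSemicontinuous
  exact this

theorem exists_doubled_max {u v : ℝ≥0 × Euc n → ℝ} (hu : UpperSemicontinuous u)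
    (hv : LowerSemicontinuous v) {h a b lam β A : ℝ} (hlam : 0 < lam) (hβ : 0 < β)
    (ha : 1 ≤ a) (hb : 1 ≤ b) (hA : 0 ≤ A)
    (H : ∀ (t s : ℝ≥0) (x y : Euc n),
      u (t, x) - v (s, y) ≤ 1 + A * (‖x - y‖ + |(t : ℝ) - s - h| + min (t : ℝ) s))
    (z₀ : (ℝ≥0 × Euc n) × (ℝ≥0 × Euc n)) (hz₀ : 0 ≤ doubled u v h a b lam β z₀) :
    ∃ (t s : ℝ≥0) (x y : Euc n),
      doubled u v h a b lam β z₀ ≤ doubled u v h a b lam β ((t, x), (s, y)) ∧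
      (∀ w, doubled u v h a b lam β w ≤ doubled u v h a b lam β ((t, x), (s, y))) ∧
      a * |(t : ℝ) - s - h| ^ 2 / 2 + b * ‖x - y‖ ^ 2 / 2 + β * ‖x‖ ^ 2 ≤
        1 + A ^ 2 + A ^ 2 / lam := by
  set C := 1 + A ^ 2 + A ^ 2 / lam with hC
  have hbd : ∀ (t s : ℝ≥0) (x y : Euc n), 0 ≤ doubled u v h a b lam β ((t, x), (s, y)) →
      lam * t + a * |(t : ℝ) - s - h| ^ 2 / 2 + b * ‖x - y‖ ^ 2 / 2 + β * ‖x‖ ^ 2 ≤ C := by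
    intro t s x y h0
    simp only [doubled] at h0
    refine penalty_bound (D := u (t, x) - v (s, y)) hlam ha hb ((H t s x y).trans ?_) ?_
    · have := min_le_left (t : ℝ) s
      gcongr
    · rw [sq_abs]; linarith
  have hbound : Bornology.IsBounded
      {z | doubled u v h a b lam β z₀ ≤ doubled u v h a b lam β z} := by
    -- The `lam` term bounds `t` and the `β` term bounds `x`; the two coupling terms then bound `s`
    -- and `y`.
    set T : ℝ := C / lam + (|h| + (1 + 2 * C)) with hT
    set X : ℝ := (1 + C / β) + (1 + 2 * C) with hX
    have hb1 : Bornology.IsBounded ((Set.Icc (0 : ℝ≥0) T.toNNReal ×ˢ closedBall (0 : Euc n) X) ×ˢ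
        (Set.Icc (0 : ℝ≥0) T.toNNReal ×ˢ closedBall (0 : Euc n) X)) :=
      ((Metric.isBounded_Icc _ _).prod isBounded_closedBall).prod
        ((Metric.isBounded_Icc _ _).prod isBounded_closedBall)
    refine hb1.subset ?_
    rintro ⟨⟨t, x⟩, ⟨s, y⟩⟩ hz
    have h1 := hbd t s x y (hz₀.trans hz)
    have p1 : 0 ≤ lam * t := by positivity
    have p2 : 0 ≤ |(t : ℝ) - s - h| ^ 2 := by positivity
    have p3 : 0 ≤ ‖x - y‖ ^ 2 := by positivity
    have p4 : 0 ≤ β * ‖x‖ ^ 2 := by positivity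
    have q2 : |(t : ℝ) - s - h| ^ 2 ≤ a * |(t : ℝ) - s - h| ^ 2 := le_mul_of_one_le_left p2 ha
    have q3 : ‖x - y‖ ^ 2 ≤ b * ‖x - y‖ ^ 2 := le_mul_of_one_le_left p3 hb
    have hC0 : 0 ≤ C := by linarith
    have e1 : (t : ℝ) ≤ C / lam := by rw [le_div_iff₀ hlam]; linarith
    have e2 : |(t : ℝ) - s - h| ≤ 1 + 2 * C := by nlinarith [sq_nonneg (|(t : ℝ) - s - h| - 1)]
    have e3 : ‖x - y‖ ≤ 1 + 2 * C := by nlinarith [sq_nonneg (‖x - y‖ - 1)]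
    have e4 : ‖x‖ ≤ 1 + C / β := by
      have : ‖x‖ ^ 2 ≤ C / β := by rw [le_div_iff₀ hβ]; linarith
      nlinarith [sq_nonneg (‖x‖ - 1)]
    have e5 : (s : ℝ) ≤ T := by
      have := neg_abs_le ((t : ℝ) - s - h)
      have := neg_abs_le h
      linarith
    have e6 : ‖y‖ ≤ X := by
      have : ‖y‖ ≤ ‖x‖ + ‖x - y‖ := by
        have := norm_sub_le x (x - y)
        rwa [sub_sub_cancel] at this
      linarith
    have := abs_nonneg h
    refine ⟨⟨⟨zero_le, ?_⟩, ?_⟩, ⟨zero_le, ?_⟩, ?_⟩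
    · exact NNReal.le_toNNReal_of_coe_le (by linarith)
    · simp only [mem_closedBall_zero_iff]; linarith
    · exact NNReal.le_toNNReal_of_coe_le e5
    · simpa only [mem_closedBall_zero_iff] using e6
  obtain ⟨⟨⟨t, x⟩, ⟨s, y⟩⟩, hz, hmax⟩ := exists_forall_le_of_isBounded
    (upperSemicontinuous_doubled hu hv h a b lam β) z₀ hbound
  refine ⟨t, s, x, y, hz, hmax, ?_⟩
  have := hbd t s x y (hz₀.trans hz)
  have p1 : 0 ≤ lam * t := by positivity
  linarith

set_option maxHeartbeats 1000000 in
/-- Comparison of a subsolution with a time-shifted supersolution. -/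
theorem comparison {F : Euc n × Euc n → ℝ} (hF : IsAdmissible F) {u v : ℝ≥0 × Euc n → ℝ}
    (hu : UpperSemicontinuous u) (hv : LowerSemicontinuous v)
    (hsub : IsViscositySubsolution F u) (hsup : IsViscositySupersolution F v) {h : ℝ}
    (H : ShiftedGrowth h u v) (t₁ s₁ : ℝ≥0) (x₁ : Euc n) (hts : (t₁ : ℝ) - s₁ = h) :
    u (t₁, x₁) ≤ v (s₁, x₁) := by
  by_contra! hlt
  obtain ⟨σ, hσ, hM⟩ : ∃ σ : ℝ, 0 < σ ∧ u (t₁, x₁) - v (s₁, x₁) = 3 * σ :=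
    -- One third is spent on the `lam` term and one on the `β` term at the starting point, leaving
    -- `σ` for the maximum.
    ⟨(u (t₁, x₁) - v (s₁, x₁)) / 3, by linarith, by ring⟩
  obtain ⟨lam, hlam, hlam'⟩ : ∃ lam : ℝ, 0 < lam ∧ lam * (t₁ + (t₁ : ℝ) ^ 2) ≤ σ := by
    refine ⟨σ / (1 + (t₁ + (t₁ : ℝ) ^ 2)), by positivity, ?_⟩
    rw [div_mul_eq_mul_div, div_le_iff₀ (by positivity)]
    nlinarith
  obtain ⟨A, hA, HA⟩ := H 1 one_pos
  obtain ⟨B, hB, HB⟩ := H (σ / 2) (by positivity)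
  set C := 1 + A ^ 2 + A ^ 2 / lam with hC
  have hC1 : 1 ≤ C := by
    have : 0 ≤ A ^ 2 / lam := by positivity
    nlinarith [sq_nonneg A]
  obtain ⟨a, ha, ha'⟩ := exists_one_le_mul_lt (2 * B) C (σ / 4) (by linarith)
    (by positivity)
  -- The order of choices is essential: `R` depends on `a` but not on `b`, so the modulus `δ` of `F`
  -- is available before `b` and `β` are chosen.
  obtain ⟨R, hR, hFR⟩ := hF.exists_norm_lt (1 + 2 * a * C)
  obtain ⟨δ, hδ, hUC⟩ := Metric.uniformContinuousOn_iff.1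
    (hF.uniformContinuousOn (R + 1) (by linarith)) lam hlam
  obtain ⟨b₀, hb₀, hb₀'⟩ := exists_one_le_mul_lt 1 C δ (by linarith) hδ
  set b := max a b₀ with hb
  obtain ⟨β, hβ, hβ1, hβ2⟩ : ∃ β : ℝ, 0 < β ∧ β * ‖x₁‖ ^ 2 ≤ σ ∧ 4 * β * C < (min δ 1) ^ 2 := by
    refine ⟨min (σ / (1 + ‖x₁‖ ^ 2)) ((min δ 1) ^ 2 / (8 * C)), by positivity, ?_, ?_⟩
    · refine (mul_le_mul_of_nonneg_right (min_le_left _ _) (by positivity)).trans ?_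
      rw [div_mul_eq_mul_div, div_le_iff₀ (by positivity)]
      nlinarith
    · have h1 : 0 < (min δ 1) ^ 2 := by positivity
      have h2 := mul_le_mul_of_nonneg_right
        (min_le_right (σ / (1 + ‖x₁‖ ^ 2)) ((min δ 1) ^ 2 / (8 * C))) (by linarith : 0 ≤ C)
      have h3 : (min δ 1) ^ 2 / (8 * C) * C = (min δ 1) ^ 2 / 8 := by field_simp
      linarith
  have hb1 : 1 ≤ b := ha.trans (le_max_left _ _)
  have hz₀ : σ ≤ doubled u v h a b lam β ((t₁, x₁), (s₁, x₁)) := by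
    have e : (t₁ : ℝ) - s₁ - h = 0 := by linarith
    simp only [doubled, e, sub_self, norm_zero]
    nlinarith
  obtain ⟨t, s, x, y, hz, hmax, hpen⟩ := exists_doubled_max hu hv hlam hβ ha hb1 hA HA
    ((t₁, x₁), (s₁, x₁)) (hσ.le.trans hz₀)
  have hge : σ ≤ u (t, x) - v (s, y) := by
    have := hz₀.trans hz
    simp only [doubled] at this
    have : 0 ≤ a * ((t : ℝ) - s - h) ^ 2 := by positivity
    have : 0 ≤ b * ‖x - y‖ ^ 2 := by positivity
    have : 0 ≤ lam * (t + (t : ℝ) ^ 2) := by positivity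
    have : 0 ≤ β * ‖x‖ ^ 2 := by positivity
    linarith
  have p1 : 0 ≤ a * |(t : ℝ) - s - h| ^ 2 / 2 := by positivity
  have p2 : 0 ≤ b * ‖x - y‖ ^ 2 / 2 := by positivity
  have p3 : 0 ≤ β * ‖x‖ ^ 2 := by positivity
  have d1 : 2 * B * |(t : ℝ) - s - h| < σ / 4 :=
    ha' a _ le_rfl (abs_nonneg _) (by linarith)
  have d2 : 2 * B * ‖x - y‖ < σ / 4 :=
    ha' b _ (le_max_left _ _) (norm_nonneg _) (by linarith)
  have d3 : ‖x - y‖ < δ := by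
    simpa using hb₀' b _ (le_max_right _ _) (norm_nonneg _) (by linarith)
  -- If one of the times vanished, the growth condition would give `u - v < σ/2 + σ/8 + σ/8 < σ`.
  -- Both points are therefore interior and both equations can be used.
  have hmin : 0 < min (t : ℝ) s := by
    by_contra! hle
    have h1 := HB t s x y
    have h2 := mul_nonneg hB (neg_nonneg.2 hle)
    linarith
  have ht : 0 < t := NNReal.coe_pos.1 (hmin.trans_le (min_le_left _ _))
  have hs : 0 < s := NNReal.coe_pos.1 (hmin.trans_le (min_le_right _ _))
  have k1 := doubling_max_sub hsub (a := a) (b := b) (lam := lam) (β := β) (τ := s + h)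
    (c := doubled u v h a b lam β ((t, x), (s, y)) + v (s, y)) (x := x) (y := y) ht
    (fun t' x' => by
      have := hmax ((t', x'), (s, y))
      simp only [doubled, ← sub_sub] at this ⊢
      linarith)
    (by simp only [doubled, ← sub_sub]; ring)
  have k2 := doubling_max_super hsup (a := a) (b := b) (τ := t - h)
    (c := doubled u v h a b lam β ((t, x), (s, y)) - u (t, x)
      + (lam * (t + (t : ℝ) ^ 2) + β * ‖x‖ ^ 2)) (x := x) (y := y) hs
    (fun s' y' => by
      have := hmax ((t, x), (s', y'))
      simp only [doubled, norm_sub_rev x] at this ⊢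
      linarith)
    (by simp only [doubled, norm_sub_rev x]; ring)
  set q := (2 * b) • (x - y) + (2 * β) • x with hq
  have hqp : ‖q - (2 * b) • (x - y)‖ < min δ 1 := by
    rw [hq, add_sub_cancel_left, norm_smul, Real.norm_of_nonneg (by positivity)]
    refine lt_of_pow_lt_pow_left₀ 2 (by positivity) (lt_of_le_of_lt ?_ hβ2)
    have : β * (β * ‖x‖ ^ 2) ≤ β * C := by gcongr; linarith
    nlinarith
  -- The subsolution inequality bounds `F` by the time slope, which is controlled through `a T² ≤ 2
  -- C`.
  have hFq : F (x, q) ≤ 1 + 2 * a * C := by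
    set T := |(t : ℝ) - s - h| with hT
    have e1 : -(2 * a * (t - (s + h))) ≤ 2 * a * T := by
      have := neg_abs_le ((t : ℝ) - s - h)
      nlinarith
    have e2 : 2 * a * T ≤ 1 + a * (a * T ^ 2) := by nlinarith [sq_nonneg (a * T - 1)]
    have e3 : a * (a * T ^ 2) ≤ a * (2 * C) :=
      mul_le_mul_of_nonneg_left (by linarith) (by linarith)
    have : 0 ≤ lam * (1 + 2 * t) := by positivity
    linarith
  have hqR := hFR x q hFq
  have hpR : ‖(2 * b) • (x - y)‖ < R + 1 := by
    have h1 := norm_sub_le q (q - (2 * b) • (x - y))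
    rw [sub_sub_cancel] at h1
    have := min_le_right δ 1
    linarith
  have hdist : dist (x, q) (y, (2 * b) • (x - y)) < δ := by
    rw [Prod.dist_eq, max_lt_iff]
    exact ⟨by rwa [dist_eq_norm], by rw [dist_eq_norm]; exact hqp.trans_le (min_le_left _ _)⟩
  -- Subtracting the two viscosity inequalities cancels the common time slope and leaves `lam (1 +
  -- 2t) ≤ F(y,p) - F(x,q)`, whereas the right side is below `lam`.
  have hFF := hUC (x, q) ⟨trivial, by rw [mem_ball_zero_iff]; linarith⟩
    (y, (2 * b) • (x - y)) ⟨trivial, by rwa [mem_ball_zero_iff]⟩ hdist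
  rw [Real.dist_eq] at hFF
  have := neg_abs_le (F (x, q) - F (y, (2 * b) • (x - y)))
  have : 0 ≤ lam * (2 * t) := by positivity
  linarith

/-! ### Stability of subsolutions. -/

/-- The squared distance to `z₀` in `ℝ × ℝⁿ`. -/
noncomputable def quad (z₀ z : ℝ × Euc n) : ℝ := (z.1 - z₀.1) ^ 2 + ‖z.2 - z₀.2‖ ^ 2

theorem contDiff_quad (z₀ : ℝ × Euc n) : ContDiff ℝ 1 (quad z₀) := by
  have h1 : ContDiff ℝ 1 (fun z : ℝ × Euc n => ‖z.2 - z₀.2‖ ^ 2) :=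
    (contDiff_snd.sub contDiff_const).norm_sq ℝ
  unfold quad
  fun_prop

theorem quad_nonneg (z₀ z : ℝ × Euc n) : 0 ≤ quad z₀ z := by unfold quad; positivity

@[simp] theorem quad_self (z₀ : ℝ × Euc n) : quad z₀ z₀ = 0 := by simp [quad]

theorem continuous_quad_incl (z₀ : ℝ × Euc n) :
    Continuous fun z : ℝ≥0 × Euc n => quad z₀ (incl z) :=
  (contDiff_quad z₀).continuous.comp continuous_incl

theorem dist_lt_of_quad_lt {z₀ z : ℝ≥0 × Euc n} {r : ℝ} (hr : 0 < r)
    (h : quad (incl z₀) (incl z) < r ^ 2) : dist z z₀ < r := by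
  simp only [quad, incl] at h
  rw [Prod.dist_eq, max_lt_iff, NNReal.dist_eq, dist_eq_norm]
  constructor
  · refine abs_lt_of_sq_lt_sq (by nlinarith [sq_nonneg ‖z.2 - z₀.2‖]) hr.le
  · exact lt_of_pow_lt_pow_left₀ 2 hr.le (by nlinarith [sq_nonneg ((z.1 : ℝ) - z₀.1)])

theorem hjOperator_add_quad {F : Euc n × Euc n → ℝ} {φ : ℝ × Euc n → ℝ}
    (hφ : ContDiffOn ℝ 1 φ (openHalf n)) {t : ℝ≥0} {x : Euc n} (ht : 0 < t) :
    hjOperator F (fun z => φ z + quad ((t : ℝ), x) z) t x = hjOperator F φ t x := by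
  refine (hjOperator_eq_of_isLocalMax hφ (hφ.add (contDiff_quad _).contDiffOn) ht
    (.of_forall fun z => ?_)).symm
  have := quad_nonneg ((t : ℝ), x) (incl z)
  have h0 : quad ((t : ℝ), x) (incl (t, x)) = 0 := quad_self _
  change φ (incl z) - (φ (incl z) + quad (t, x) (incl z)) ≤
    φ (incl (t, x)) - (φ (incl (t, x)) + quad (t, x) (incl (t, x)))
  rw [h0]
  linarith

theorem hjOperator_sub_quad {F : Euc n × Euc n → ℝ} {φ : ℝ × Euc n → ℝ}
    (hφ : ContDiffOn ℝ 1 φ (openHalf n)) {t : ℝ≥0} {x : Euc n} (ht : 0 < t) :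
    hjOperator F (fun z => φ z - quad ((t : ℝ), x) z) t x = hjOperator F φ t x := by
  refine hjOperator_eq_of_isLocalMax (hφ.sub (contDiff_quad _).contDiffOn) hφ ht
    (.of_forall fun z => ?_)
  have := quad_nonneg ((t : ℝ), x) (incl z)
  have h0 : quad ((t : ℝ), x) (incl (t, x)) = 0 := quad_self _
  change φ (incl z) - quad (t, x) (incl z) - φ (incl z) ≤
    φ (incl (t, x)) - quad (t, x) (incl (t, x)) - φ (incl (t, x))
  rw [h0]
  linarith

/-- A function that is approximated by subsolutions which do not exceed it by much is a
subsolution. This covers suprema, their envelopes, and uniform limits. -/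
theorem isViscositySubsolution_of_approx {F : Euc n × Euc n → ℝ} (hF : Continuous F)
    {u : ℝ≥0 × Euc n → ℝ}
    (h : ∀ z₀ : ℝ≥0 × Euc n, ∀ δ : ℝ, 0 < δ → ∃ w : ℝ≥0 × Euc n → ℝ,
      UpperSemicontinuous w ∧ IsViscositySubsolution F w ∧ (∀ z, w z ≤ u z + δ) ∧
      ∃ z, dist z z₀ < δ ∧ u z₀ - δ < w z) :
    IsViscositySubsolution F u := by
  intro φ hφ t x ht hm
  by_contra! hpos
  set z₀ : ℝ≥0 × Euc n := (t, x) with hz₀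
  -- Adding the square makes the maximum strict without changing the first derivatives at `z₀`, so
  -- maxima for the approximants stay nearby.
  set φ' : ℝ × Euc n → ℝ := fun z => φ z + quad (incl z₀) z with hφ'
  have hsm : ContDiffOn ℝ 1 φ' (openHalf n) := hφ.add (contDiff_quad _).contDiffOn
  have hpos' : 0 < hjOperator F φ' t x := by
    rw [hφ']
    exact hpos.trans_eq (hjOperator_add_quad hφ ht).symm
  have hev : ∀ᶠ z : ℝ≥0 × Euc n in 𝓝 z₀, 0 < hjOperator F φ' z.1 z.2 ∧
      u z - φ (incl z) ≤ u z₀ - φ (incl z₀) ∧ 0 < z.1 :=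
    (eventually_lt_hjOperator hF hsm ht hpos').and
      (hm.and (continuous_fst.continuousAt.eventually_const_lt ht))
  obtain ⟨r, hr, hball⟩ := Metric.nhds_basis_closedBall.eventually_iff.1 hev
  have hc : ContinuousAt (fun z => φ' (incl z)) z₀ := continuousAt_incl_comp hsm ht
  have hφ0 : φ' (incl z₀) = φ (incl z₀) := by simp [hφ']
  have hε : 0 < r ^ 2 / 2 := by positivity
  obtain ⟨ρ, hρ, hρ'⟩ := Metric.continuousAt_iff.1 hc _ hε
  -- The error `r²/4` enters twice and the oscillation of `φ'` costs `r²/2`; the total `r²` keeps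
  -- the maximum off the boundary of the ball.
  obtain ⟨w, hw, hwsub, hwle, z₁, hz₁, hwz₁⟩ := h z₀ (min (min ρ r) (r ^ 2 / 4)) (by positivity)
  have m1 : dist z₁ z₀ < ρ := hz₁.trans_le ((min_le_left _ _).trans (min_le_left _ _))
  have m2 : dist z₁ z₀ < r := hz₁.trans_le ((min_le_left _ _).trans (min_le_right _ _))
  have m3 := min_le_right (min ρ r) (r ^ 2 / 4)
  have husc : UpperSemicontinuousOn (fun z => w z + -φ' (incl z)) (closedBall z₀ r) := by
    refine (hw.upperSemicontinuousOn _).add fun z hz => ?_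
    exact (continuousAt_incl_comp hsm
      (hball hz).2.2).neg.continuousWithinAt.upperSemicontinuousWithinAt
  obtain ⟨y, hy, hymax⟩ := husc.exists_isMaxOn ⟨z₀, mem_closedBall_self hr.le⟩
    (isCompact_closedBall z₀ r)
  have k1 : w z₁ + -φ' (incl z₁) ≤ w y + -φ' (incl y) := hymax (mem_closedBall.2 m2.le)
  have k2 := (abs_lt.1 (hρ' m1)).2
  have k3 := (hball hy).2.1
  have k4 := hwle y
  have k5 : φ' (incl y) = φ (incl y) + quad (incl z₀) (incl y) := rfl
  have hylt : dist y z₀ < r := dist_lt_of_quad_lt hr (by linarith)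
  have hloc : IsLocalMax (fun z : ℝ≥0 × Euc n => w z - φ' ((z.1 : ℝ), z.2)) y := by
    filter_upwards [closedBall_mem_nhds_of_mem (mem_ball.2 hylt)] with z hz
    have : w z + -φ' (incl z) ≤ w y + -φ' (incl y) := hymax hz
    change w z - φ' (incl z) ≤ w y - φ' (incl y)
    linarith
  have := hwsub φ' hsm y.1 y.2 (hball hy).2.2 hloc
  exact absurd (hball hy).1 (not_lt.2 this)

/-! ### Semicontinuous envelopes and the Perron bump. -/

section Envelope

variable {Z : Type*} [TopologicalSpace Z]

/-- The upper semicontinuous envelope. -/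
noncomputable def uscEnvelope (f : Z → ℝ) (z : Z) : ℝ := limsup f (𝓝 z)

variable {f : Z → ℝ} (hb : ∀ z, ∃ M, ∀ᶠ z' in 𝓝 z, |f z'| ≤ M)

include hb

theorem isBoundedUnder_le_nhds (z : Z) : (𝓝 z).IsBoundedUnder (· ≤ ·) f := by
  obtain ⟨M, hM⟩ := hb z
  exact ⟨M, hM.mono fun z' h => (abs_le.1 h).2⟩

theorem isBoundedUnder_ge_nhds (z : Z) : (𝓝 z).IsBoundedUnder (· ≥ ·) f := by
  obtain ⟨M, hM⟩ := hb z
  exact ⟨-M, hM.mono fun z' h => (abs_le.1 h).1⟩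

theorem uscEnvelope_le_of_eventually {z : Z} {c : ℝ} (h : ∀ᶠ z' in 𝓝 z, f z' ≤ c) :
    uscEnvelope f z ≤ c :=
  limsup_le_of_le (isBoundedUnder_ge_nhds hb z).isCoboundedUnder_le h

theorem frequently_lt_of_lt_uscEnvelope {z : Z} {c : ℝ} (h : c < uscEnvelope f z) :
    ∃ᶠ z' in 𝓝 z, c < f z' :=
  frequently_lt_of_lt_limsup (isBoundedUnder_ge_nhds hb z).isCoboundedUnder_le h

theorem eventually_lt_of_uscEnvelope_lt {z : Z} {c : ℝ} (h : uscEnvelope f z < c) :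
    ∀ᶠ z' in 𝓝 z, f z' < c :=
  eventually_lt_of_limsup_lt h (isBoundedUnder_le_nhds hb z)

theorem le_uscEnvelope (z : Z) : f z ≤ uscEnvelope f z :=
  le_of_forall_gt fun _ hc => (eventually_lt_of_uscEnvelope_lt hb hc).self_of_nhds

theorem upperSemicontinuous_uscEnvelope : UpperSemicontinuous (uscEnvelope f) := by
  intro z c hc
  obtain ⟨d, hd, hdc⟩ := exists_between hc
  filter_upwards [(eventually_lt_of_uscEnvelope_lt hb hd).eventually_nhds] with z' hz'
  exact (uscEnvelope_le_of_eventually hb (hz'.mono fun _ h => h.le)).trans_lt hdc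

theorem uscEnvelope_le_of_le {b : Z → ℝ} (hbc : Continuous b) (h : ∀ z, f z ≤ b z) (z : Z) :
    uscEnvelope f z ≤ b z := by
  refine le_of_forall_gt_imp_ge_of_dense fun c hc => uscEnvelope_le_of_eventually hb ?_
  filter_upwards [hbc.continuousAt.eventually_lt_const hc] with z' hz'
  exact (h z').trans hz'.le

end Envelope

/-- The lower semicontinuous envelope. -/
noncomputable def lscEnvelope {Z : Type*} [TopologicalSpace Z] (f : Z → ℝ) (z : Z) : ℝ :=
  -uscEnvelope (fun z => -f z) z

/-- The bump construction: a maximal subsolution below a supersolution `U` has a lower envelope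
that is a supersolution. -/
theorem isViscositySupersolution_lscEnvelope {F : Euc n × Euc n → ℝ} (hF : Continuous F)
    {f U : ℝ≥0 × Euc n → ℝ} (hb : ∀ z, ∃ M, ∀ᶠ z' in 𝓝 z, |f z'| ≤ M)
    (hf : UpperSemicontinuous f) (hfsub : IsViscositySubsolution F f)
    (hU : Continuous U) (hUsup : IsViscositySupersolution F U) (hfU : ∀ z, f z ≤ U z)
    (hmaxi : ∀ w : ℝ≥0 × Euc n → ℝ, UpperSemicontinuous w → IsViscositySubsolution F w →
      (∀ z, w z ≤ U z) → ∀ z, w z ≤ f z) :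
    IsViscositySupersolution F (lscEnvelope f) := by
  have hb' : ∀ z, ∃ M, ∀ᶠ z' in 𝓝 z, |-f z'| ≤ M := by simpa only [abs_neg] using hb
  have hle : ∀ z, lscEnvelope f z ≤ f z := fun z => by
    have := le_uscEnvelope hb' z
    simp only [lscEnvelope]; linarith
  intro φ hφ t x ht hm
  by_contra! hneg
  set z₀ : ℝ≥0 × Euc n := (t, x) with hz₀
  set m := lscEnvelope f z₀ - φ (incl z₀) with hm_def
  have hm' : ∀ᶠ z in 𝓝 z₀, m ≤ lscEnvelope f z - φ (incl z) := hm
  rcases ((hle z₀).trans (hfU z₀)).eq_or_lt with heq | hlt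
  -- Where the lower envelope touches `U`, `φ` also touches `U` from below, and `U` is itself a
  -- supersolution.
  · have : IsLocalMin (fun z : ℝ≥0 × Euc n => U z - φ ((z.1 : ℝ), z.2)) (t, x) := by
      filter_upwards [hm'] with z hz
      change U z₀ - φ (incl z₀) ≤ U z - φ (incl z)
      have := (hle z).trans (hfU z)
      linarith
    exact absurd (hUsup φ hφ t x ht this) (not_le.2 hneg)
  set φ' : ℝ × Euc n → ℝ := fun z => φ z - quad (incl z₀) z with hφ'
  have hsm : ContDiffOn ℝ 1 φ' (openHalf n) := hφ.sub (contDiff_quad _).contDiffOn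
  have hneg' : hjOperator F φ' t x < 0 := by
    rw [hφ']
    exact (hjOperator_sub_quad hφ ht).trans_lt hneg
  have hφ0 : φ' (incl z₀) = φ (incl z₀) := by simp [hφ']
  have hφc : ∀ z : ℝ≥0 × Euc n, 0 < z.1 → ContinuousAt (fun z => φ' (incl z)) z :=
    fun z hz => continuousAt_incl_comp hsm hz
  set gap := (U z₀ - lscEnvelope f z₀) / 2 with hgap
  have hgap0 : 0 < gap := by linarith
  have hev : ∀ᶠ z : ℝ≥0 × Euc n in 𝓝 z₀, hjOperator F φ' z.1 z.2 < 0 ∧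
      m ≤ lscEnvelope f z - φ (incl z) ∧ 0 < z.1 ∧ φ' (incl z) + m + gap < U z := by
    refine (eventually_hjOperator_lt hF hsm ht hneg').and (hm'.and
      (((continuous_fst.continuousAt (x := z₀)).eventually_const_lt ht).and ?_))
    refine (((hφc z₀ ht).add_const m).add_const gap).eventually_lt hU.continuousAt ?_
    rw [hφ0]
    linarith
  obtain ⟨r, hr, hball⟩ := Metric.nhds_basis_ball.eventually_iff.1 hev
  -- The first bound places `quad < 2δ` inside the ball; the second keeps the raised bump below `U`.
  set δ := min (r ^ 2 / 2) gap with hδ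
  have hδ0 : 0 < δ := by positivity
  have hδ1 : 2 * δ ≤ r ^ 2 := by linarith [min_le_left (r ^ 2 / 2) gap]
  have hδ2 : δ ≤ gap := min_le_right _ _
  have hin : ∀ z, quad (incl z₀) (incl z) < 2 * δ → z ∈ ball z₀ r := fun z hz =>
    dist_lt_of_quad_lt hr (hz.trans_le hδ1)
  set g : ℝ≥0 × Euc n → ℝ := fun z => φ' (incl z) + (m + δ) with hg
  -- On the overlap ring `δ ≤ quad < 2δ` the lowering by `quad` cancels the raising by `δ`, so the
  -- glued function equals `f` there and has no seam.
  have hgf : ∀ z, z ∈ ball z₀ r → δ ≤ quad (incl z₀) (incl z) → g z ≤ f z := by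
    intro z hz hq
    have h1 := (hball hz).2.1
    have h2 := hle z
    simp only [hg, hφ']
    linarith
  classical
  set w : ℝ≥0 × Euc n → ℝ := fun z =>
    if quad (incl z₀) (incl z) < 2 * δ then max (f z) (g z) else f z with hw
  have hw1 : ∀ z, quad (incl z₀) (incl z) < 2 * δ → w z = max (f z) (g z) := fun z hz =>
    if_pos hz
  have hw2 : ∀ z, δ ≤ quad (incl z₀) (incl z) → w z = f z := by
    intro z hz
    by_cases h : quad (incl z₀) (incl z) < 2 * δ
    · rw [hw1 z h]; exact max_eq_left (hgf z (hin z h) hz)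
    · exact if_neg h
  have hfw : ∀ z, f z ≤ w z := by
    intro z
    by_cases h : quad (incl z₀) (incl z) < 2 * δ
    · rw [hw1 z h]; exact le_max_left _ _
    · exact (if_neg h).ge
  have hwusc : UpperSemicontinuous w := by
    intro z
    by_cases h : quad (incl z₀) (incl z) < 2 * δ
    · have hgc : ContinuousAt g z := (hφc z (hball (hin z h)).2.2.1).add_const _
      intro c hc
      rw [hw1 z h] at hc
      filter_upwards [hf z c ((le_max_left _ _).trans_lt hc),
        hgc.eventually_lt_const ((le_max_right _ _).trans_lt hc),
        (continuous_quad_incl (incl z₀)).continuousAt.eventually_lt_const h] with z' h1' h2' h3'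
      rw [hw1 z' h3']
      exact max_lt h1' h2'
    · intro c hc
      rw [hw2 z (by linarith)] at hc
      filter_upwards [hf z c hc, (continuous_quad_incl (incl z₀)).continuousAt.eventually_const_lt
        (show δ < quad (incl z₀) (incl z) by linarith)] with z' h1' h2'
      rw [hw2 z' h2'.le]
      exact h1'
  have hwU : ∀ z, w z ≤ U z := by
    intro z
    by_cases h : quad (incl z₀) (incl z) < 2 * δ
    · rw [hw1 z h]
      refine max_le (hfU z) ?_
      have := (hball (hin z h)).2.2.2
      simp only [hg]
      linarith
    · exact (if_neg h).le.trans (hfU z)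
  have hwsub : IsViscositySubsolution F w := by
    intro ψ hψ s y hs hmax
    have hmax' : ∀ᶠ z in 𝓝 (s, y), w z - ψ (incl z) ≤ w (s, y) - ψ (incl (s, y)) := hmax
    by_cases hcase : w (s, y) = f (s, y)
    · refine hfsub ψ hψ s y hs ?_
      filter_upwards [hmax'] with z hz
      change f z - ψ (incl z) ≤ f (s, y) - ψ (incl (s, y))
      have := hfw z
      linarith
    · have hlt' : quad (incl z₀) (incl (s, y)) < 2 * δ := by
        by_contra! h
        exact hcase (hw2 _ (by linarith))
      have hwg : w (s, y) = g (s, y) := by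
        rw [hw1 _ hlt'] at hcase ⊢
        rcases max_choice (f (s, y)) (g (s, y)) with h | h
        · exact absurd h hcase
        · exact h
      have hloc : IsLocalMax (fun z : ℝ≥0 × Euc n => φ' (incl z) - ψ (incl z)) (s, y) := by
        filter_upwards [hmax', (continuous_quad_incl (incl z₀)).continuousAt.eventually_lt_const
          hlt'] with z h1 h2
        have h3 : g z ≤ w z := by rw [hw1 z h2]; exact le_max_right _ _
        rw [hwg] at h1
        simp only [hg] at h1 h3
        linarith
      rw [← hjOperator_eq_of_isLocalMax hsm hψ hs hloc]
      exact (hball (hin _ hlt')).1.le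
  have hwf := hmaxi w hwusc hwsub hwU
  -- Points where `f` nearly attains its lower envelope exist arbitrarily close to `z₀`; there `g`
  -- exceeds `f`, contradicting maximality.
  have hfreq : ∃ᶠ z in 𝓝 z₀, f z < lscEnvelope f z₀ + δ / 2 := by
    have := frequently_lt_of_lt_uscEnvelope hb' (z := z₀) (c := -(lscEnvelope f z₀ + δ / 2))
      (by simp only [lscEnvelope]; linarith)
    exact this.mono fun z hz => by linarith
  have hev2 : ∀ᶠ z in 𝓝 z₀, lscEnvelope f z₀ + δ / 2 < g z := by
    refine ((hφc z₀ ht).add_const (m + δ)).eventually_const_lt ?_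
    change lscEnvelope f z₀ + δ / 2 < φ' (incl z₀) + (m + δ)
    rw [hφ0]
    linarith
  have hev3 : ∀ᶠ z in 𝓝 z₀, quad (incl z₀) (incl z) < 2 * δ :=
    (continuous_quad_incl (incl z₀)).continuousAt.eventually_lt_const (by simpa using hδ0)
  obtain ⟨z, h1, h2, h3⟩ := (hfreq.and_eventually (hev2.and hev3)).exists
  have h4 := hwf z
  rw [hw1 z h3] at h4
  have := le_max_right (f z) (g z)
  linarith

/-! ### Barriers and Perron's method for Lipschitz data. -/

/-- A test function touching from above has time derivative `-C` and, by `norm_le_of_isLocalMax`,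
spatial gradient of norm at most `L`. -/
theorem isViscositySubsolution_barrier {F : Euc n × Euc n → ℝ} {u₀ : Euc n → ℝ} {L : ℝ≥0}
    (hu₀ : LipschitzWith L u₀) {C : ℝ} (hC : ∀ x p, ‖p‖ ≤ L → F (x, p) ≤ C) :
    IsViscositySubsolution F fun z => u₀ z.2 - C * z.1 := by
  intro φ hφ t x ht hm
  have hd := differentiableAt_of_contDiffOn_openHalf hφ (NNReal.coe_pos.2 ht) (x := x)
  have hp := norm_le_of_isLocalMax hu₀ (hasGradientAt_space hd) (by
    have hc : ContinuousAt (fun y : Euc n => (t, y)) x := by fun_prop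
    filter_upwards [hc.eventually hm] with y hy
    change u₀ y - C * t - φ (t, y) ≤ u₀ x - C * t - φ (t, x) at hy
    linarith)
  have hm2 := eventually_nhds_of_eventually_incl (P := fun z =>
    u₀ z.2 - C * z.1 - φ z ≤ u₀ x - C * t - φ (t, x)) ht hm
  have hloc : IsLocalMax (fun s : ℝ => u₀ x - C * s - φ (s, x)) t := by
    have hc : ContinuousAt (fun s : ℝ => (s, x)) (t : ℝ) := by fun_prop
    exact hc.eventually hm2
  have h0 := hloc.hasDerivAt_eq_zero
    ((((hasDerivAt_id (t : ℝ)).const_mul C).const_sub (u₀ x)).sub (hasDerivAt_time hd))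
  rw [hjOperator_eq_fderiv hd]
  have := hC x _ hp
  linarith

theorem isViscositySupersolution_barrier {F : Euc n × Euc n → ℝ} {u₀ : Euc n → ℝ} {L : ℝ≥0}
    (hu₀ : LipschitzWith L u₀) {C : ℝ} (hC : ∀ x p, ‖p‖ ≤ L → -C ≤ F (x, p)) :
    IsViscositySupersolution F fun z => u₀ z.2 + C * z.1 := by
  rw [isViscositySupersolution_iff]
  have := isViscositySubsolution_barrier (F := dualHamiltonian F) hu₀.neg (C := C)
    (fun x p hp => by
      have := hC x (-p) (by rwa [norm_neg])
      simp only [dualHamiltonian]; linarith)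
  convert this using 2 with z
  simp only [Pi.neg_apply]
  ring

theorem add_le_abs_add (t s h : ℝ) : t + s ≤ |h| + 2 * (|t - s - h| + min t s) := by
  have h1 : |t - s| ≤ |h| + |t - s - h| := by
    have := abs_add_le h (t - s - h)
    rwa [add_sub_cancel] at this
  have h2 := abs_nonneg (t - s - h)
  have h3 := abs_sub_comm t s
  rcases le_total t s with h | h
  · rw [min_eq_left h]
    have := le_abs_self (s - t)
    linarith
  · rw [min_eq_right h]
    have := le_abs_self (t - s)
    linarith

theorem shiftedGrowth_of_barriers {u v : ℝ≥0 × Euc n → ℝ} {u₀ : Euc n → ℝ} {L : ℝ≥0}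
    (hu₀ : LipschitzWith L u₀) {C : ℝ} (hC0 : 0 ≤ C) (hu : ∀ z, u z ≤ u₀ z.2 + C * z.1)
    (hv : ∀ z, u₀ z.2 - C * z.1 ≤ v z) (h : ℝ) :
    ShiftedGrowth h u fun z => v z + C * |h| := by
  intro δ hδ
  refine ⟨L + 2 * C, by positivity, fun t s x y => ?_⟩
  have h1 := hu (t, x)
  have h2 := hv (s, y)
  simp only at h1 h2
  have h3 := hu₀.dist_le_mul x y
  rw [Real.dist_eq, dist_eq_norm] at h3
  have h4 := le_abs_self (u₀ x - u₀ y)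
  have h6 := mul_le_mul_of_nonneg_left (add_le_abs_add (t : ℝ) s h) hC0
  have h7 : 0 ≤ (2 * C) * ‖x - y‖ := by positivity
  have h8 : 0 ≤ (L : ℝ) * (|(t : ℝ) - s - h| + min (t : ℝ) s) := by positivity
  linarith

/-- Perron's method for Lipschitz initial data. -/
theorem exists_solution_of_lipschitz {F : Euc n × Euc n → ℝ} (hF : IsAdmissible F)
    {u₀ : Euc n → ℝ} {L : ℝ≥0} (hu₀ : LipschitzWith L u₀) {C : ℝ} (hC0 : 0 ≤ C)
    (hC : ∀ x p, ‖p‖ ≤ L → |F (x, p)| ≤ C) :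
    ∃ u : ℝ≥0 × Euc n → ℝ, Continuous u ∧ IsViscositySubsolution F u ∧
      IsViscositySupersolution F u ∧ ∀ z, |u z - u₀ z.2| ≤ C * z.1 := by
  set Lo : ℝ≥0 × Euc n → ℝ := fun z => u₀ z.2 - C * z.1 with hLo
  set U : ℝ≥0 × Euc n → ℝ := fun z => u₀ z.2 + C * z.1 with hU
  have hcu : Continuous fun z : ℝ≥0 × Euc n => u₀ z.2 := hu₀.continuous.comp continuous_snd
  have hct : Continuous fun z : ℝ≥0 × Euc n => C * (z.1 : ℝ) := by fun_prop
  have hLoc : Continuous Lo := hcu.sub hct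
  have hUc : Continuous U := hcu.add hct
  have hLosub : IsViscositySubsolution F Lo :=
    isViscositySubsolution_barrier hu₀ fun x p hp => (abs_le.1 (hC x p hp)).2
  have hUsup : IsViscositySupersolution F U :=
    isViscositySupersolution_barrier hu₀ fun x p hp => (abs_le.1 (hC x p hp)).1
  have hLU : ∀ z, Lo z ≤ U z := fun z => by
    have : 0 ≤ C * (z.1 : ℝ) := by positivity
    simp only [hLo, hU]; linarith
  let S : Set (ℝ≥0 × Euc n → ℝ) :=
    {w | UpperSemicontinuous w ∧ IsViscositySubsolution F w ∧ ∀ z, w z ≤ U z}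
  have hLoS : Lo ∈ S := ⟨hLoc.upperSemicontinuous, hLosub, hLU⟩
  have : Nonempty S := ⟨⟨Lo, hLoS⟩⟩
  set f : ℝ≥0 × Euc n → ℝ := fun z => ⨆ w : S, w.1 z with hf
  have hbdd : ∀ z, BddAbove (Set.range fun w : S => w.1 z) := fun z =>
    ⟨U z, by rintro _ ⟨w, rfl⟩; exact w.2.2.2 z⟩
  have hSf : ∀ w ∈ S, ∀ z, w z ≤ f z := fun w hw z => le_ciSup (hbdd z) ⟨w, hw⟩
  have hfU : ∀ z, f z ≤ U z := fun z => ciSup_le fun w => w.2.2.2 z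
  have hb : ∀ z, ∃ M, ∀ᶠ z' in 𝓝 z, |f z'| ≤ M := by
    intro z
    refine ⟨max (U z + 1) (-(Lo z - 1)), ?_⟩
    filter_upwards [hUc.continuousAt.eventually_lt_const (lt_add_one (U z)),
      hLoc.continuousAt.eventually_const_lt (sub_one_lt (Lo z))] with z' h1 h2
    have h3 := hSf Lo hLoS z'
    have h4 := hfU z'
    rw [abs_le]
    have h5 := le_max_left (U z + 1) (-(Lo z - 1))
    have h6 := le_max_right (U z + 1) (-(Lo z - 1))
    constructor <;> linarith
  have hb' : ∀ z, ∃ M, ∀ᶠ z' in 𝓝 z, |-f z'| ≤ M := by simpa only [abs_neg] using hb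
  -- The envelope of the supremum is again a competitor, so it cannot exceed the supremum: `f` is
  -- already upper semicontinuous.
  have hgS : uscEnvelope f ∈ S := by
    refine ⟨upperSemicontinuous_uscEnvelope hb, ?_, uscEnvelope_le_of_le hb hUc hfU⟩
    refine isViscositySubsolution_of_approx hF.continuous fun z₀ δ hδ => ?_
    obtain ⟨z, hz1, hz2⟩ := ((frequently_lt_of_lt_uscEnvelope hb
      (sub_lt_self (uscEnvelope f z₀) hδ)).and_eventually (ball_mem_nhds z₀ hδ)).exists
    obtain ⟨w, hw⟩ := exists_lt_of_lt_ciSup hz1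
    refine ⟨w.1, w.2.1, w.2.2.1, fun z' => ?_, z, hz2, hw⟩
    have h1 := hSf w.1 w.2 z'
    have h2 := le_uscEnvelope hb z'
    linarith
  have hgf : uscEnvelope f = f :=
    funext fun z => le_antisymm (hSf _ hgS z) (le_uscEnvelope hb z)
  rw [hgf] at hgS
  have hsup : IsViscositySupersolution F (lscEnvelope f) :=
    isViscositySupersolution_lscEnvelope hF.continuous hb hgS.1 hgS.2.1 hUc hUsup hfU
      fun w h1 h2 h3 => hSf w ⟨h1, h2, h3⟩
  have hlsc : LowerSemicontinuous (lscEnvelope f) := by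
    intro z c hc
    have := upperSemicontinuous_uscEnvelope hb' z (-c) (by simp only [lscEnvelope] at hc; linarith)
    filter_upwards [this] with z' hz'
    simp only [lscEnvelope]
    linarith
  have hLof : ∀ z, Lo z ≤ lscEnvelope f z := fun z => by
    have := uscEnvelope_le_of_le hb' hLoc.neg (fun z => neg_le_neg (hSf Lo hLoS z)) z
    simp only [lscEnvelope, Pi.neg_apply] at this ⊢
    linarith
  have hgrow : ShiftedGrowth 0 f (lscEnvelope f) := by
    simpa using shiftedGrowth_of_barriers hu₀ hC0 hfU hLof 0
  have hle : ∀ z, lscEnvelope f z ≤ f z := fun z => by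
    have := le_uscEnvelope hb' z
    simp only [lscEnvelope]; linarith
  have heq : lscEnvelope f = f := funext fun z => le_antisymm (hle z)
    (comparison hF hgS.1 hlsc hgS.2.1 hsup hgrow z.1 z.1 z.2 (sub_self _))
  rw [heq] at hlsc hsup
  refine ⟨f, continuous_iff_lower_upperSemicontinuous.2 ⟨hlsc, hgS.1⟩, hgS.2.1, hsup, fun z => ?_⟩
  have h1 := hfU z
  have h2 := hSf Lo hLoS z
  simp only [hU, hLo] at h1 h2
  rw [abs_le]
  constructor <;> linarith

/-! ### Lipschitz bounds in time and in space. -/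

theorem IsViscositySupersolution.add_const {F : Euc n × Euc n → ℝ} {v : ℝ≥0 × Euc n → ℝ}
    (hv : IsViscositySupersolution F v) (c : ℝ) : IsViscositySupersolution F fun z => v z + c := by
  intro φ hφ t x ht hm
  refine hv φ hφ t x ht ?_
  filter_upwards [hm] with z hz
  change v (t, x) + c - φ (t, x) ≤ v z + c - φ (incl z) at hz
  change v (t, x) - φ (t, x) ≤ v z - φ (incl z)
  linarith

/-- Comparison with shift `h = t - s` is applied to `u` and `u + C |h|`; the barriers supply the
required order when one of the times is zero. -/
theorem abs_sub_le_mul_time {F : Euc n × Euc n → ℝ} (hF : IsAdmissible F)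
    {u : ℝ≥0 × Euc n → ℝ} (hu : Continuous u) (hsub : IsViscositySubsolution F u)
    (hsup : IsViscositySupersolution F u) {u₀ : Euc n → ℝ} {L : ℝ≥0}
    (hu₀ : LipschitzWith L u₀) {C : ℝ} (hC0 : 0 ≤ C) (hC : ∀ z, |u z - u₀ z.2| ≤ C * z.1)
    (t s : ℝ≥0) (x : Euc n) : |u (t, x) - u (s, x)| ≤ C * |(t : ℝ) - s| := by
  have key : ∀ t s : ℝ≥0, u (t, x) ≤ u (s, x) + C * |(t : ℝ) - s| := fun t s =>
    comparison hF hu.upperSemicontinuous (hu.add continuous_const).lowerSemicontinuous hsub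
      (hsup.add_const _) (shiftedGrowth_of_barriers hu₀ hC0
        (fun z => by linarith [(abs_le.1 (hC z)).2]) (fun z => by linarith [(abs_le.1 (hC z)).1])
        ((t : ℝ) - s)) t s x rfl
  rw [abs_le]
  have h1 := key t s
  have h2 := key s t
  rw [abs_sub_comm] at h2
  constructor <;> linarith

theorem hasGradientAt_smooth_cone (M κ c : ℝ) (hκ : 0 < κ) (x x₀ : Euc n) :
    HasGradientAt (fun ξ : Euc n => c + M * √(‖ξ - x₀‖ ^ 2 + κ ^ 2))
      ((M / √(‖x - x₀‖ ^ 2 + κ ^ 2)) • (x - x₀)) x := by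
  rw [hasGradientAt_iff_hasFDerivAt]
  have h1 := ((((hasFDerivAt_id x).sub_const x₀).norm_sq).add_const (κ ^ 2)).sqrt
    (by positivity)
  refine ((h1.const_mul M).const_add c).congr_fderiv ?_
  ext v
  change M * (1 / (2 * √(‖x - x₀‖ ^ 2 + κ ^ 2)) * (2 • inner ℝ (x - x₀) v)) =
    inner ℝ ((M / √(‖x - x₀‖ ^ 2 + κ ^ 2)) • (x - x₀)) v
  rw [real_inner_smul_left, nsmul_eq_mul]
  have : 0 < √(‖x - x₀‖ ^ 2 + κ ^ 2) := by positivity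
  push_cast
  field_simp

theorem cone_max_sub {F : Euc n × Euc n → ℝ} {u : ℝ≥0 × Euc n → ℝ}
    (hsub : IsViscositySubsolution F u) {M κ K τ : ℝ} (hκ : 0 < κ) {t : ℝ≥0} {x x₀ : Euc n}
    (ht : 0 < t)
    (hmax : ∀ z : ℝ≥0 × Euc n,
      u z - (K * ((z.1 : ℝ) - τ) ^ 2 + M * √(‖z.2 - x₀‖ ^ 2 + κ ^ 2)) ≤
        u (t, x) - (K * ((t : ℝ) - τ) ^ 2 + M * √(‖x - x₀‖ ^ 2 + κ ^ 2))) :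
    2 * K * (t - τ) + F (x, (M / √(‖x - x₀‖ ^ 2 + κ ^ 2)) • (x - x₀)) ≤ 0 := by
  set φ : ℝ × Euc n → ℝ := fun z => K * (z.1 - τ) ^ 2 + M * √(‖z.2 - x₀‖ ^ 2 + κ ^ 2) with hφ
  have hsm : ContDiff ℝ 1 φ := by
    have h1 : ContDiff ℝ 1 (fun z : ℝ × Euc n => ‖z.2 - x₀‖ ^ 2 + κ ^ 2) :=
      ((contDiff_snd.sub contDiff_const).norm_sq ℝ).add contDiff_const
    have h2 := h1.sqrt (fun z => by positivity)
    rw [hφ]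
    fun_prop
  have key := hsub φ hsm.contDiffOn t x ht (.of_forall hmax)
  have hd : HasDerivAt (fun s : ℝ => φ (s, x)) (2 * K * (t - τ)) t := by
    have h1 := (((hasDerivAt_id (t : ℝ)).sub_const τ).pow 2).const_mul K
    refine (h1.add_const (M * √(‖x - x₀‖ ^ 2 + κ ^ 2))).congr_deriv ?_
    simp only [id, Nat.cast_ofNat, Nat.reduceSub, pow_one]
    ring
  have hg : HasGradientAt (fun ξ : Euc n => φ (t, ξ))
      ((M / √(‖x - x₀‖ ^ 2 + κ ^ 2)) • (x - x₀)) x :=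
    hasGradientAt_smooth_cone M κ (K * ((t : ℝ) - τ) ^ 2) hκ x x₀
  rwa [hjOperator_eq hd hg] at key

/-- The slope `M ≥ L + 1` beats the spatial growth of `u₀` with a surplus `‖x - x₀‖`, and the
quadratic in time beats `C t`. -/
theorem isBounded_superlevel_cone {u : ℝ≥0 × Euc n → ℝ} {u₀ : Euc n → ℝ} {L : ℝ≥0}
    (hu₀ : LipschitzWith L u₀) {C : ℝ} (hC : ∀ z, u z ≤ u₀ z.2 + C * z.1)
    {M κ K τ : ℝ} (hM : L + 1 ≤ M) (hK : 0 < K) (x₀ : Euc n) (c : ℝ) :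
    Bornology.IsBounded {z : ℝ≥0 × Euc n |
      c ≤ u z - (K * ((z.1 : ℝ) - τ) ^ 2 + M * √(‖z.2 - x₀‖ ^ 2 + κ ^ 2))} := by
  set D := u₀ x₀ - c + C ^ 2 / (2 * K) + C * τ with hD
  have hb1 : Bornology.IsBounded (Set.Icc (0 : ℝ≥0) (τ + 1 + 2 * D / K).toNNReal ×ˢ
      closedBall x₀ D) := (Metric.isBounded_Icc _ _).prod isBounded_closedBall
  refine hb1.subset ?_
  rintro ⟨t, x⟩ hz
  have hz : c ≤ u (t, x) - (K * ((t : ℝ) - τ) ^ 2 + M * √(‖x - x₀‖ ^ 2 + κ ^ 2)) := hz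
  have h1 := hC (t, x)
  simp only at h1
  have h2 := hu₀.dist_le_mul x x₀
  rw [Real.dist_eq, dist_eq_norm] at h2
  have h3 := le_abs_self (u₀ x - u₀ x₀)
  have h4 : ‖x - x₀‖ ≤ √(‖x - x₀‖ ^ 2 + κ ^ 2) :=
    Real.le_sqrt_of_sq_le (by nlinarith [sq_nonneg κ])
  have hL : 0 ≤ (L : ℝ) := L.2
  have h5 : (L + 1) * ‖x - x₀‖ ≤ M * √(‖x - x₀‖ ^ 2 + κ ^ 2) := by gcongr; linarith
  have h6 : C * (t - τ) ≤ K * ((t : ℝ) - τ) ^ 2 / 2 + C ^ 2 / (2 * K) := by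
    have : 0 ≤ (K * ((t : ℝ) - τ) - C) ^ 2 / (2 * K) := by positivity
    have e : (K * ((t : ℝ) - τ) - C) ^ 2 / (2 * K) =
        K * ((t : ℝ) - τ) ^ 2 / 2 + C ^ 2 / (2 * K) - C * (t - τ) := by field_simp; ring
    linarith
  have h7 : ‖x - x₀‖ + K * ((t : ℝ) - τ) ^ 2 / 2 ≤ D := by linarith
  have h8 : 0 ≤ K * ((t : ℝ) - τ) ^ 2 / 2 := by positivity
  refine ⟨⟨zero_le, NNReal.le_toNNReal_of_coe_le ?_⟩, ?_⟩
  · have : ((t : ℝ) - τ) ^ 2 ≤ 2 * D / K := by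
      rw [le_div_iff₀ hK]
      linarith [norm_nonneg (x - x₀)]
    change (t : ℝ) ≤ _
    nlinarith [sq_nonneg ((t : ℝ) - τ - 1)]
  · rw [mem_closedBall, dist_eq_norm]
    change ‖x - x₀‖ ≤ D
    linarith

/-- Coercivity turns a Lipschitz bound in time into one in space. -/
theorem sub_le_mul_space {F : Euc n × Euc n → ℝ} {u : ℝ≥0 × Euc n → ℝ} (hu : Continuous u)
    (hsub : IsViscositySubsolution F u) {u₀ : Euc n → ℝ} {L : ℝ≥0} (hu₀ : LipschitzWith L u₀)
    (hinit : ∀ x, u (0, x) = u₀ x) {C : ℝ} (hC0 : 0 ≤ C)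
    (hC : ∀ (t s : ℝ≥0) x, |u (t, x) - u (s, x)| ≤ C * |(t : ℝ) - s|)
    {R : ℝ} (hR : 0 < R) (hFR : ∀ x p, F (x, p) ≤ 2 * C → ‖p‖ < R) {M : ℝ} (hM1 : L + 1 ≤ M)
    (hM2 : R + 1 ≤ M) {t₀ : ℝ≥0} (ht₀ : 0 < t₀) (x₀ x₁ : Euc n) :
    u (t₀, x₁) ≤ u (t₀, x₀) + M * ‖x₁ - x₀‖ := by
  refine le_of_forall_pos_le_add fun ε' hε' => ?_
  -- The three parts pay for the time drift, the continuity of `u(t₀, ·)` at `x₀`, and the smoothing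
  -- `M κ` of the cone.
  obtain ⟨ε, hε, rfl⟩ : ∃ ε : ℝ, 0 < ε ∧ ε' = 3 * ε := ⟨ε' / 3, by positivity, by ring⟩
  have ht₀' : (0 : ℝ) < t₀ := NNReal.coe_pos.2 ht₀
  have hM0 : 0 < M := by linarith
  obtain ⟨ρ, hρ, hρ'⟩ := Metric.continuousAt_iff.1
    (show ContinuousAt (fun x => u (t₀, x)) x₀ by fun_prop) ε hε
  obtain ⟨κ, hκ, hκ1, hκ2, hκ3⟩ : ∃ κ : ℝ, 0 < κ ∧ κ ≤ 1 ∧ M * κ ≤ ε ∧ R * κ ≤ ρ := by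
    refine ⟨min 1 (min (ε / M) (ρ / R)), by positivity, min_le_left _ _, ?_, ?_⟩
    · rw [← le_div_iff₀' hM0]
      exact (min_le_right _ _).trans (min_le_left _ _)
    · rw [← le_div_iff₀' hR]
      exact (min_le_right _ _).trans (min_le_right _ _)
  -- The first bound on `K` excludes a maximum at time zero; the second makes the time drift `C |t -
  -- t₀| ≤ C²/K` at most `ε`.
  obtain ⟨K, hK, hK1, hK2⟩ : ∃ K : ℝ, 0 < K ∧ C * t₀ + M < K * (t₀ : ℝ) ^ 2 ∧ C ^ 2 ≤ ε * K := by
    refine ⟨(C * t₀ + M) / (t₀ : ℝ) ^ 2 + C ^ 2 / ε + 1, by positivity, ?_, ?_⟩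
    · have e : ((C * t₀ + M) / (t₀ : ℝ) ^ 2 + C ^ 2 / ε + 1) * (t₀ : ℝ) ^ 2 =
          (C * t₀ + M) + (C ^ 2 / ε + 1) * (t₀ : ℝ) ^ 2 := by field_simp; ring
      have : 0 < (C ^ 2 / ε + 1) * (t₀ : ℝ) ^ 2 := by positivity
      linarith
    · have e : ε * ((C * t₀ + M) / (t₀ : ℝ) ^ 2 + C ^ 2 / ε + 1) =
          C ^ 2 + ε * ((C * t₀ + M) / (t₀ : ℝ) ^ 2 + 1) := by field_simp; ring
      have : 0 < ε * ((C * t₀ + M) / (t₀ : ℝ) ^ 2 + 1) := by positivity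
      linarith
  set Ψ : ℝ≥0 × Euc n → ℝ := fun z =>
    u z - (K * ((z.1 : ℝ) - t₀) ^ 2 + M * √(‖z.2 - x₀‖ ^ 2 + κ ^ 2)) with hΨ
  have hΨc : Continuous Ψ := by rw [hΨ]; fun_prop
  have hup : ∀ z, u z ≤ u₀ z.2 + C * z.1 := fun z => by
    have := (abs_le.1 (hC z.1 0 z.2)).2
    rw [hinit, NNReal.coe_zero, sub_zero, abs_of_nonneg (NNReal.coe_nonneg _)] at this
    have : u z - u₀ z.2 ≤ C * z.1 := this
    linarith
  obtain ⟨⟨t, x⟩, hge, hmax⟩ := exists_forall_le_of_isBounded hΨc.upperSemicontinuous (t₀, x₀)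
    (isBounded_superlevel_cone hu₀ hup hM1 hK x₀ _)
  have hsqrt : ∀ y : Euc n, ‖y - x₀‖ ≤ √(‖y - x₀‖ ^ 2 + κ ^ 2) ∧
      √(‖y - x₀‖ ^ 2 + κ ^ 2) ≤ ‖y - x₀‖ + κ := fun y => by
    refine ⟨Real.le_sqrt_of_sq_le (by nlinarith [sq_nonneg κ]), ?_⟩
    rw [Real.sqrt_le_left (by positivity)]
    nlinarith [mul_nonneg (norm_nonneg (y - x₀)) hκ.le]
  have htpos : 0 < t := by
    rw [pos_iff_ne_zero]
    rintro rfl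
    have h1 : Ψ (t₀, x₀) = u (t₀, x₀) - M * κ := by
      simp [hΨ, Real.sqrt_sq hκ.le]
    have h2 : Ψ (0, x) = u₀ x - (K * (t₀ : ℝ) ^ 2 + M * √(‖x - x₀‖ ^ 2 + κ ^ 2)) := by
      simp [hΨ, hinit]
    have h3 := (abs_le.1 (hC t₀ 0 x₀)).1
    rw [hinit, NNReal.coe_zero, sub_zero, abs_of_pos ht₀'] at h3
    have h4 := hu₀.dist_le_mul x x₀
    rw [Real.dist_eq, dist_eq_norm] at h4
    have h5 := le_abs_self (u₀ x - u₀ x₀)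
    have h6 : L * ‖x - x₀‖ ≤ M * √(‖x - x₀‖ ^ 2 + κ ^ 2) := by
      have := (hsqrt x).1
      gcongr
      linarith
    have h7 : M * κ ≤ M := mul_le_of_le_one_right hM0.le hκ1
    linarith
  -- Comparing the maximum with `(t₀, x)` gives `K (t - t₀)² ≤ C |t - t₀|`, so the time slope of the
  -- test function is at least `-2C`.
  have hKd : K * |(t : ℝ) - t₀| ≤ C := by
    have h1 := hmax (t₀, x)
    simp only [hΨ, sub_self] at h1
    have h2 := (abs_le.1 (hC t t₀ x)).2
    rcases (abs_nonneg ((t : ℝ) - t₀)).eq_or_lt with h | h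
    · rw [← h, mul_zero]; exact hC0
    · refine le_of_mul_le_mul_right ?_ h
      have h3 := sq_abs ((t : ℝ) - t₀)
      have : K * |(t : ℝ) - t₀| * |(t : ℝ) - t₀| = K * ((t : ℝ) - t₀) ^ 2 := by rw [← h3]; ring
      linarith
  have hpR := hFR x _ (show F (x, (M / √(‖x - x₀‖ ^ 2 + κ ^ 2)) • (x - x₀)) ≤ 2 * C by
    have h1 := cone_max_sub hsub hκ htpos hmax
    have h2 := mul_le_mul_of_nonneg_left (neg_abs_le ((t : ℝ) - t₀)) hK.le
    linarith)
  -- The cone has slope close to `M > R` away from its tip, so a slope below `R` is possible only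
  -- within distance `R κ` of `x₀`.
  have hxR : ‖x - x₀‖ < R * κ := by
    have hs : 0 < √(‖x - x₀‖ ^ 2 + κ ^ 2) := by positivity
    rw [norm_smul, Real.norm_of_nonneg (by positivity), div_mul_eq_mul_div, div_lt_iff₀ hs] at hpR
    have h1 : (M * ‖x - x₀‖) ^ 2 < (R * √(‖x - x₀‖ ^ 2 + κ ^ 2)) ^ 2 :=
      pow_lt_pow_left₀ hpR (by positivity) two_ne_zero
    rw [mul_pow, mul_pow, Real.sq_sqrt (by positivity)] at h1
    have h2 : R ^ 2 + 1 ≤ M ^ 2 := by nlinarith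
    refine lt_of_pow_lt_pow_left₀ 2 (by positivity) ?_
    rw [mul_pow]
    nlinarith [mul_le_mul_of_nonneg_right h2 (sq_nonneg ‖x - x₀‖)]
  have f1 := hmax (t₀, x₁)
  simp only [hΨ, sub_self] at f1
  have f2 := (abs_le.1 (hC t t₀ x)).2
  have f3 : C * |(t : ℝ) - t₀| ≤ ε := by
    refine le_of_mul_le_mul_right ?_ hK
    have := mul_le_mul_of_nonneg_left hKd hC0
    linarith
  have f4 := (abs_lt.1 (hρ' (x := x) (by rw [dist_eq_norm]; linarith))).2
  have f5 := mul_le_mul_of_nonneg_left (hsqrt x₁).2 hM0.le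
  have f6 : 0 ≤ M * √(‖x - x₀‖ ^ 2 + κ ^ 2) := by positivity
  have f7 : 0 ≤ K * ((t : ℝ) - t₀) ^ 2 := by positivity
  linarith

/-- A solution staying within `C t` of Lipschitz initial data is Lipschitz, with a constant that
depends only on the Hamiltonian and the Lipschitz constant of the data. -/
theorem exists_lipschitzWith {F : Euc n × Euc n → ℝ} (hF : IsAdmissible F) (L : ℝ≥0) {C : ℝ}
    (hC0 : 0 ≤ C) :
    ∃ K : ℝ≥0, ∀ u₀ : Euc n → ℝ, LipschitzWith L u₀ → ∀ u : ℝ≥0 × Euc n → ℝ, Continuous u →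
      IsViscositySubsolution F u → IsViscositySupersolution F u →
      (∀ z, |u z - u₀ z.2| ≤ C * z.1) → LipschitzWith K u := by
  obtain ⟨R, hR, hFR⟩ := hF.exists_norm_lt (2 * C)
  set M : ℝ := max (L + 1) (R + 1) with hM
  have hM1 : L + 1 ≤ M := le_max_left _ _
  have hM2 : R + 1 ≤ M := le_max_right _ _
  have hM0 : 0 ≤ M := by linarith
  refine ⟨⟨C + M, by linarith⟩, fun u₀ hu₀ u hu hsub hsup hC => ?_⟩
  have hinit : ∀ x, u (0, x) = u₀ x := fun x => by
    have := hC (0, x)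
    simp only [NNReal.coe_zero, mul_zero] at this
    exact sub_eq_zero.1 (abs_nonpos_iff.1 this)
  have htime := abs_sub_le_mul_time hF hu hsub hsup hu₀ hC0 hC
  refine LipschitzWith.of_le_add_mul _ ?_
  rintro ⟨t, x⟩ ⟨s, y⟩
  have h1 := (abs_le.1 (htime t s x)).2
  have h2 : u (s, x) ≤ u (s, y) + M * ‖x - y‖ := by
    rcases eq_or_ne s 0 with rfl | hs
    · have h4 := hu₀.dist_le_mul x y
      rw [Real.dist_eq, dist_eq_norm] at h4
      have h5 := le_abs_self (u₀ x - u₀ y)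
      rw [hinit, hinit]
      have : L * ‖x - y‖ ≤ M * ‖x - y‖ := by gcongr; linarith
      linarith
    · exact sub_le_mul_space hu hsub hu₀ hinit hC0 htime hR hFR hM1 hM2 (pos_iff_ne_zero.2 hs) y x
  have h3 : |(t : ℝ) - s| ≤ dist (t, x) (s, y) := by
    rw [Prod.dist_eq, ← NNReal.dist_eq]; exact le_max_left _ _
  have h4 : ‖x - y‖ ≤ dist (t, x) (s, y) := by
    rw [Prod.dist_eq, ← dist_eq_norm]; exact le_max_right _ _
  have h5 := mul_le_mul_of_nonneg_left h3 hC0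
  have h6 := mul_le_mul_of_nonneg_left h4 hM0
  change u (t, x) ≤ u (s, y) + (C + M) * dist (t, x) (s, y)
  linarith

/-! ### The Lipschitz constant as the essential supremum of the gradient. -/

theorem gradSupNorm_le {u₀ : Euc n → ℝ} {L : ℝ≥0} (hu₀ : LipschitzWith L u₀) :
    gradSupNorm u₀ ≤ L := by
  rw [gradSupNorm, eLpNorm_exponent_top]
  refine eLpNormEssSup_le_of_ae_nnnorm_bound (.of_forall fun x => ?_)
  exact norm_fderiv_le_of_lipschitz ℝ hu₀

/-- A Lipschitz function has Lipschitz constant `‖Du‖_∞`. -/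
theorem lipschitzWith_gradSupNorm {u₀ : Euc n → ℝ} {L : ℝ≥0} (hu₀ : LipschitzWith L u₀) :
    LipschitzWith (gradSupNorm u₀).toNNReal u₀ := by
  set c : ℝ≥0 := (gradSupNorm u₀).toNNReal with hc
  have hfin : gradSupNorm u₀ ≠ ∞ := ne_top_of_le_ne_top ENNReal.coe_ne_top (gradSupNorm_le hu₀)
  have hae : ∀ᵐ x : Euc n, DifferentiableAt ℝ u₀ x ∧ ‖fderiv ℝ u₀ x‖ ≤ c := by
    have h1 : ∀ᵐ x : Euc n, ‖fderiv ℝ u₀ x‖ₑ ≤ gradSupNorm u₀ := by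
      rw [gradSupNorm, eLpNorm_exponent_top]
      exact enorm_ae_le_eLpNormEssSup _ _
    filter_upwards [hu₀.ae_differentiableAt, h1] with x hx1 hx2
    refine ⟨hx1, ?_⟩
    rw [← ENNReal.coe_toNNReal hfin, ← hc] at hx2
    exact_mod_cast hx2
  -- Rademacher's theorem gives a full-measure set of good points; a measurable subset of full
  -- measure is extracted so that Fubini applies.
  obtain ⟨S, hS, hSm, hSae⟩ : ∃ S : Set (Euc n),
      (∀ x ∈ S, DifferentiableAt ℝ u₀ x ∧ ‖fderiv ℝ u₀ x‖ ≤ c) ∧ MeasurableSet S ∧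
        ∀ᵐ x : Euc n, x ∈ S := by
    refine ⟨(toMeasurable volume {x | ¬(DifferentiableAt ℝ u₀ x ∧ ‖fderiv ℝ u₀ x‖ ≤ c)})ᶜ,
      fun x hx => ?_, (measurableSet_toMeasurable _ _).compl, ?_⟩
    · by_contra h
      exact hx (subset_toMeasurable _ _ h)
    · rw [ae_iff] at hae ⊢
      simpa only [Set.mem_compl_iff, not_not, Set.ofPred_mem_eq, measure_toMeasurable] using hae
  have key : ∀ v y : Euc n, |u₀ (y + v) - u₀ y| ≤ c * ‖v‖ := by
    intro v
    have hline : ∀ᵐ y : Euc n, ∀ᵐ t : ℝ, y + t • v ∈ S := by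
      have hm : MeasurableSet {z : Euc n × ℝ | z.1 + z.2 • v ∈ S} :=
        hSm.preimage (f := fun z : Euc n × ℝ => z.1 + z.2 • v) (by fun_prop)
      rw [Measure.ae_ae_comm hm]
      refine .of_forall fun t => ?_
      exact (measurePreserving_add_right volume (t • v)).quasiMeasurePreserving.ae hSae
    -- On almost every line in direction `v` the derivative bound can be integrated. The increment
    -- bound then holds on a dense set of base points, and everywhere by continuity.
    have hdense := Measure.dense_of_ae (p := fun y => |u₀ (y + v) - u₀ y| ≤ c * ‖v‖) (by
      filter_upwards [hline] with y hy
      set g : ℝ → ℝ := fun t => u₀ (y + t • v) with hg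
      have hgL : LipschitzWith (L * ‖v‖₊) g := by
        refine hu₀.comp (LipschitzWith.of_dist_le_mul fun a b => ?_)
        rw [dist_add_left, dist_eq_norm, ← sub_smul, norm_smul, mul_comm, coe_nnnorm,
          Real.dist_eq, Real.norm_eq_abs]
      have hint := (hgL.lipschitzOnWith (s := Set.uIcc 0 1)).absolutelyContinuousOnInterval
        |>.integral_deriv_eq_sub
      have hbound : ‖∫ t in (0 : ℝ)..1, deriv g t‖ ≤ c * ‖v‖ * |1 - 0| := by
        refine intervalIntegral.norm_integral_le_of_norm_le_const_ae ?_
        filter_upwards [hy] with t ht _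
        obtain ⟨h1, h2⟩ := hS _ ht
        have h3 : HasDerivAt (fun t : ℝ => y + t • v) v t := by
          simpa using ((hasDerivAt_id t).smul_const v).const_add y
        have h4 : HasDerivAt g (fderiv ℝ u₀ (y + t • v) v) t :=
          h1.hasFDerivAt.comp_hasDerivAt t h3
        rw [h4.deriv]
        exact (ContinuousLinearMap.le_opNorm _ _).trans (by gcongr)
      rw [hint] at hbound
      simpa [hg] using hbound)
    have hclosed : IsClosed {y | |u₀ (y + v) - u₀ y| ≤ c * ‖v‖} := by
      have := hu₀.continuous
      exact isClosed_le (by fun_prop) continuous_const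
    intro y
    have := hdense y
    rwa [hclosed.closure_eq] at this
  refine LipschitzWith.of_dist_le_mul fun x y => ?_
  have := key (x - y) y
  rwa [add_sub_cancel, ← Real.dist_eq, ← dist_eq_norm] at this

/-! ### Uniformly continuous data: contraction, uniqueness and existence. -/

/-- Uniformly continuous functions grow at most linearly, with an arbitrarily small offset. -/
theorem exists_abs_sub_le_of_uniformContinuous {V : Type*} [NormedAddCommGroup V]
    [NormedSpace ℝ V] {f : V → ℝ} (hf : UniformContinuous f) {δ : ℝ} (hδ : 0 < δ) :
    ∃ A : ℝ, 0 ≤ A ∧ ∀ x y, |f x - f y| ≤ δ + A * ‖x - y‖ := by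
  obtain ⟨ρ, hρ, hρ'⟩ := Metric.uniformContinuous_iff.1 hf δ hδ
  -- A segment is cut into `N` pieces of length at most `ρ/2`, each costing at most `δ`. The half
  -- makes the distance strictly less than `ρ`.
  have step : ∀ (N : ℕ) (x y : V), ‖x - y‖ ≤ N * (ρ / 2) → |f x - f y| ≤ N * δ := by
    intro N
    induction N with
    | zero =>
      intro x y h
      have : x = y := by
        rw [← sub_eq_zero, ← norm_le_zero_iff]
        simpa using h
      simp [this]
    | succ N ih =>
      intro x y h
      push_cast at h ⊢
      have hN : (0 : ℝ) < N + 1 := by positivity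
      set w : V := x - ((N : ℝ) / (N + 1)) • (x - y) with hw
      have h1 : ‖x - w‖ ≤ N * (ρ / 2) := by
        rw [hw, sub_sub_cancel, norm_smul, Real.norm_of_nonneg (by positivity),
          div_mul_eq_mul_div, div_le_iff₀ hN]
        calc (N : ℝ) * ‖x - y‖ ≤ N * ((N + 1) * (ρ / 2)) := by gcongr
          _ = _ := by ring
      have h2 : ‖w - y‖ ≤ ρ / 2 := by
        have e : w - y = ((1 : ℝ) / (N + 1)) • (x - y) := by
          have : (1 : ℝ) / (N + 1) = 1 - N / (N + 1) := by field_simp; ring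
          rw [this, sub_smul, one_smul, hw]
          abel
        rw [e, norm_smul, Real.norm_of_nonneg (by positivity), div_mul_eq_mul_div,
          div_le_iff₀ hN]
        linarith
      have h3 := ih x w h1
      have h4 : |f w - f y| < δ := hρ' (by rw [dist_eq_norm]; linarith)
      have h5 := abs_sub_le (f x) (f w) (f y)
      linarith
  refine ⟨δ / (ρ / 2), by positivity, fun x y => ?_⟩
  have h1 := Nat.le_ceil (‖x - y‖ / (ρ / 2))
  have h2 := Nat.ceil_lt_add_one (show 0 ≤ ‖x - y‖ / (ρ / 2) by positivity)
  rw [div_le_iff₀ (by positivity)] at h1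
  have h3 := step _ x y h1
  have h4 := mul_le_mul_of_nonneg_right h2.le hδ.le
  have e : δ / (ρ / 2) * ‖x - y‖ = ‖x - y‖ / (ρ / 2) * δ := by ring
  linarith

theorem exists_abs_sub_le_of_uniformContinuous_half {u : ℝ≥0 × Euc n → ℝ}
    (hu : UniformContinuous u) {δ : ℝ} (hδ : 0 < δ) :
    ∃ A : ℝ, 0 ≤ A ∧ ∀ (t s : ℝ≥0) (x y : Euc n),
      |u (t, x) - u (s, y)| ≤ δ + A * (|(t : ℝ) - s| + ‖x - y‖) := by
  have hmap : UniformContinuous fun z : ℝ × Euc n => u (Real.toNNReal z.1, z.2) :=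
    hu.comp ((Real.lipschitzWith_toNNReal.uniformContinuous.comp uniformContinuous_fst).prodMk
      uniformContinuous_snd)
  obtain ⟨A, hA, h⟩ := exists_abs_sub_le_of_uniformContinuous hmap hδ
  refine ⟨A, hA, fun t s x y => ?_⟩
  have h1 := h (t, x) (s, y)
  simp only [Real.toNNReal_coe, Prod.mk_sub_mk, Prod.norm_mk, Real.norm_eq_abs] at h1
  refine h1.trans ?_
  gcongr
  exact max_le_add_of_nonneg (abs_nonneg _) (norm_nonneg _)

/-- Both functions are compared with their values at `(0, x)`; the times `t` and `s` are in turn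
controlled by `|t - s| + min t s`. -/
theorem shiftedGrowth_of_uniformContinuous {u v : ℝ≥0 × Euc n → ℝ} (hu : UniformContinuous u)
    (hv : UniformContinuous v) (h : ∀ x, u (0, x) ≤ v (0, x)) : ShiftedGrowth 0 u v := by
  intro δ hδ
  obtain ⟨A, hA, hA'⟩ := exists_abs_sub_le_of_uniformContinuous_half hu (half_pos hδ)
  obtain ⟨B, hB, hB'⟩ := exists_abs_sub_le_of_uniformContinuous_half hv (half_pos hδ)
  refine ⟨2 * A + 2 * B, by positivity, fun t s x y => ?_⟩
  have h1 := (abs_le.1 (hA' t 0 x x)).2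
  have h2 := (abs_le.1 (hB' 0 s x y)).2
  have h3 := h x
  simp only [NNReal.coe_zero, sub_zero, zero_sub, abs_neg, sub_self, norm_zero, add_zero,
    NNReal.abs_eq] at h1 h2 ⊢
  have h4 := add_le_abs_add (t : ℝ) s 0
  rw [abs_zero, zero_add, sub_zero] at h4
  have ht : (t : ℝ) ≤ 2 * (|(t : ℝ) - s| + min (t : ℝ) s) := by linarith [s.coe_nonneg]
  have hs : (s : ℝ) ≤ 2 * (|(t : ℝ) - s| + min (t : ℝ) s) := by linarith [t.coe_nonneg]
  have h5 := mul_le_mul_of_nonneg_left ht hA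
  have h6 := mul_le_mul_of_nonneg_left hs hB
  have h7 : 0 ≤ (2 * A + B) * ‖x - y‖ := by positivity
  linarith

/-- The contraction property of uniformly continuous solutions. -/
theorem IsUCSolution.le_add_const {F : Euc n × Euc n → ℝ} (hF : IsAdmissible F)
    {u₀ v₀ : Euc n → ℝ} {u v : ℝ≥0 × Euc n → ℝ} (hu : IsUCSolution F u₀ u)
    (hv : IsUCSolution F v₀ v) {c : ℝ} (h : ∀ x, u₀ x ≤ v₀ x + c) (z : ℝ≥0 × Euc n) :
    u z ≤ v z + c := by
  have hvc : UniformContinuous fun z => v z + c := hv.uniformContinuous.add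
    uniformContinuous_const
  exact comparison hF hu.uniformContinuous.continuous.upperSemicontinuous
    hvc.continuous.lowerSemicontinuous hu.solution.subsolution
    (hv.solution.supersolution.add_const c)
    (shiftedGrowth_of_uniformContinuous hu.uniformContinuous hvc fun x => by
      rw [hu.initial, hv.initial]; exact h x) z.1 z.1 z.2 (sub_self _)

theorem IsUCSolution.unique {F : Euc n × Euc n → ℝ} (hF : IsAdmissible F)
    {u₀ : Euc n → ℝ} {u v : ℝ≥0 × Euc n → ℝ} (hu : IsUCSolution F u₀ u)
    (hv : IsUCSolution F u₀ v) : u = v := by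
  funext z
  have h1 := hu.le_add_const hF hv (c := 0) (fun x => by simp) z
  have h2 := hv.le_add_const hF hu (c := 0) (fun x => by simp) z
  linarith

/-- Existence for Lipschitz data, with a uniform Lipschitz bound. -/
theorem exists_lipschitz_isUCSolution {F : Euc n × Euc n → ℝ} (hF : IsAdmissible F) (L : ℝ≥0) :
    ∃ K : ℝ≥0, ∀ u₀ : Euc n → ℝ, LipschitzWith L u₀ →
      ∃ u, IsUCSolution F u₀ u ∧ LipschitzWith K u := by
  obtain ⟨C, hC0, hC⟩ := hF.exists_abs_le L
  obtain ⟨K, hK⟩ := exists_lipschitzWith hF L hC0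
  refine ⟨K, fun u₀ hu₀ => ?_⟩
  obtain ⟨u, hu, hsub, hsup, hbd⟩ := exists_solution_of_lipschitz hF hu₀ hC0 hC
  have hlip := hK u₀ hu₀ u hu hsub hsup hbd
  refine ⟨u, ⟨hlip.uniformContinuous, fun x => ?_, hu.continuousOn, hsub, hsup⟩, hlip⟩
  have := hbd (0, x)
  simp only [NNReal.coe_zero, mul_zero] at this
  exact sub_eq_zero.1 (abs_nonpos_iff.1 this)

/-- Uniformly continuous functions are uniform limits of Lipschitz functions. -/
theorem exists_lipschitz_approx {V : Type*} [NormedAddCommGroup V] [NormedSpace ℝ V] {f : V → ℝ}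
    (hf : UniformContinuous f) {δ : ℝ} (hδ : 0 < δ) :
    ∃ g : V → ℝ, (∃ L : ℝ≥0, LipschitzWith L g) ∧ ∀ x, |g x - f x| ≤ δ := by
  obtain ⟨A, hA, h⟩ := exists_abs_sub_le_of_uniformContinuous hf hδ
  have hlow : ∀ x y, f x - δ ≤ f y + A * ‖x - y‖ := fun x y => by
    have := (abs_le.1 (h x y)).2
    linarith
  have hbdd : ∀ x, BddBelow (Set.range fun y => f y + A * ‖x - y‖) := fun x =>
    ⟨f x - δ, by rintro _ ⟨y, rfl⟩; exact hlow x y⟩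
  -- Inf-convolution with the cone of slope `A`: choosing `y = x` bounds it above by `f`, and the
  -- near-Lipschitz estimate bounds it below by `f - δ`.
  refine ⟨fun x => ⨅ y, (f y + A * ‖x - y‖), ⟨⟨A, hA⟩, LipschitzWith.of_le_add_mul _ ?_⟩, ?_⟩
  · intro x x'
    rw [← sub_le_iff_le_add]
    refine le_ciInf fun y => ?_
    have h1 := ciInf_le (hbdd x) y
    have h2 := mul_le_mul_of_nonneg_left (norm_sub_le_norm_sub_add_norm_sub x x' y) hA
    rw [dist_eq_norm]
    change (⨅ y, (f y + A * ‖x - y‖)) - A * ‖x - x'‖ ≤ _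
    linarith
  · intro x
    have h1 := ciInf_le (hbdd x) x
    have h2 := le_ciInf (hlow x)
    simp only [sub_self, norm_zero, mul_zero, add_zero] at h1
    rw [abs_le]
    constructor <;> linarith

/-- Uniform limits of solutions are solutions. -/
theorem isUCSolution_of_approx {F : Euc n × Euc n → ℝ} (hF : Continuous F) {u₀ : Euc n → ℝ}
    {u : ℝ≥0 × Euc n → ℝ}
    (h : ∀ δ : ℝ, 0 < δ → ∃ w₀ w, IsUCSolution F w₀ w ∧ (∀ x, |w₀ x - u₀ x| ≤ δ) ∧
      ∀ z, |w z - u z| < δ) : IsUCSolution F u₀ u := by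
  have huc : UniformContinuous u := by
    refine Metric.uniformContinuous_iff.2 fun ε hε => ?_
    obtain ⟨w₀, w, hw, -, hwu⟩ := h (ε / 3) (by positivity)
    obtain ⟨ρ, hρ, hρ'⟩ := Metric.uniformContinuous_iff.1 hw.uniformContinuous (ε / 3)
      (by positivity)
    refine ⟨ρ, hρ, fun {a b} hab => ?_⟩
    have h1 := abs_lt.1 (hwu a)
    have h2 := abs_lt.1 (hwu b)
    have h3 := abs_lt.1 (hρ' hab)
    rw [Real.dist_eq, abs_lt]
    constructor <;> linarith
  refine ⟨huc, fun x => ?_, huc.continuous.continuousOn, ?_, ?_⟩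
  · refine eq_of_forall_dist_le fun ε hε => ?_
    obtain ⟨w₀, w, hw, hw₀, hwu⟩ := h (ε / 2) (by positivity)
    have h1 := abs_lt.1 (hwu (0, x))
    have h2 := abs_le.1 (hw₀ x)
    rw [hw.initial] at h1
    rw [Real.dist_eq, abs_le]
    constructor <;> linarith
  · refine isViscositySubsolution_of_approx hF fun z₀ δ hδ => ?_
    obtain ⟨w₀, w, hw, -, hwu⟩ := h δ hδ
    exact ⟨w, hw.uniformContinuous.continuous.upperSemicontinuous, hw.solution.subsolution,
      fun z => by linarith [(abs_lt.1 (hwu z)).2], z₀, by rwa [dist_self],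
      by linarith [(abs_lt.1 (hwu z₀)).1]⟩
  · rw [isViscositySupersolution_iff]
    refine isViscositySubsolution_of_approx (continuous_dualHamiltonian hF) fun z₀ δ hδ => ?_
    obtain ⟨w₀, w, hw, -, hwu⟩ := h δ hδ
    exact ⟨fun z => -w z, hw.uniformContinuous.continuous.neg.upperSemicontinuous,
      isViscositySupersolution_iff.1 hw.solution.supersolution,
      fun z => by linarith [(abs_lt.1 (hwu z)).1], z₀, by rwa [dist_self],
      by linarith [(abs_lt.1 (hwu z₀)).2]⟩

theorem exists_isUCSolution {F : Euc n × Euc n → ℝ} (hF : IsAdmissible F) {u₀ : Euc n → ℝ}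
    (hu₀ : UniformContinuous u₀) : ∃ u, IsUCSolution F u₀ u := by
  have hstep : ∀ k : ℕ, ∃ w₀ w, IsUCSolution F w₀ w ∧ ∀ x, |w₀ x - u₀ x| ≤ 1 / ((k : ℝ) + 1) := by
    intro k
    obtain ⟨g, ⟨L, hL⟩, hg⟩ := exists_lipschitz_approx hu₀ (Nat.one_div_pos_of_nat (n := k))
    obtain ⟨K, hK⟩ := exists_lipschitz_isUCSolution hF L
    obtain ⟨w, hw, -⟩ := hK g hL
    exact ⟨g, w, hw, hg⟩
  choose w₀ w hw hw₀ using hstep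
  -- By contraction, the uniform errors in the initial data control the differences of the solutions
  -- at all times.
  have hdiff : ∀ j k z, w j z ≤ w k z + (1 / ((j : ℝ) + 1) + 1 / ((k : ℝ) + 1)) := fun j k z =>
    (hw j).le_add_const hF (hw k) (fun x => by
      have h1 := abs_le.1 (hw₀ j x)
      have h2 := abs_le.1 (hw₀ k x)
      linarith) z
  have hlim : ∀ z, ∃ l, Tendsto (fun k => w k z) atTop (𝓝 l) := by
    intro z
    refine cauchySeq_tendsto_of_complete (cauchySeq_of_le_tendsto_0
      (fun N : ℕ => 2 * (1 / ((N : ℝ) + 1))) (fun j k N hj hk => ?_) ?_)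
    · have h1 := hdiff j k z
      have h2 := hdiff k j z
      have h3 := Nat.one_div_le_one_div (α := ℝ) hj
      have h4 := Nat.one_div_le_one_div (α := ℝ) hk
      rw [Real.dist_eq, abs_le]
      constructor <;> linarith
    · simpa using (tendsto_one_div_add_atTop_nhds_zero_nat (𝕜 := ℝ)).const_mul 2
  choose u hu using hlim
  have hbd : ∀ k z, |w k z - u z| ≤ 1 / ((k : ℝ) + 1) := by
    intro k z
    have hz : Tendsto (fun j : ℕ => 1 / ((j : ℝ) + 1) + 1 / ((k : ℝ) + 1)) atTop
        (𝓝 (1 / ((k : ℝ) + 1))) := by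
      simpa using (tendsto_one_div_add_atTop_nhds_zero_nat (𝕜 := ℝ)).add_const (1 / ((k : ℝ) + 1))
    have h1 := le_of_tendsto_of_tendsto' (hu z) (hz.const_add (w k z)) fun j => hdiff j k z
    have h2 := le_of_tendsto_of_tendsto' (tendsto_const_nhds (x := w k z)) ((hu z).add hz)
      fun j => (hdiff k j z).trans_eq (by ring)
    rw [abs_le]
    constructor <;> linarith
  refine ⟨u, isUCSolution_of_approx hF.continuous fun δ hδ => ?_⟩
  obtain ⟨k, hk⟩ := exists_nat_one_div_lt hδ
  exact ⟨w₀ k, w k, hw k, fun x => (hw₀ k x).trans hk.le, fun z => (hbd k z).trans_lt hk⟩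

end HJ

theorem mainTheorem3 (n : ℕ) (F : HJ.Euc n × HJ.Euc n → ℝ) (hF : HJ.IsAdmissible F) :
    (∀ u₀ : HJ.Euc n → ℝ, UniformContinuous u₀ →
      ∃! u : ℝ≥0 × HJ.Euc n → ℝ, HJ.IsUCSolution F u₀ u) ∧
    (∃ K : ℝ≥0∞ → ℝ≥0, ∀ u₀ : HJ.Euc n → ℝ, (∃ L : ℝ≥0, LipschitzWith L u₀) →
      ∀ u : ℝ≥0 × HJ.Euc n → ℝ, HJ.IsUCSolution F u₀ u →
        LipschitzWith (K (HJ.gradSupNorm u₀)) u) := by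
  refine ⟨fun u₀ hu₀ => ?_, ?_⟩
  · obtain ⟨u, hu⟩ := HJ.exists_isUCSolution hF hu₀
    exact ⟨u, hu, fun v hv => hv.unique hF hu⟩
  · choose K hK using HJ.exists_lipschitz_isUCSolution hF
    -- The constant may be taken at `‖Du₀‖_∞`, itself a finite Lipschitz constant of `u₀`;
    -- uniqueness identifies the given solution with the constructed one.
    refine ⟨fun G => K G.toNNReal, fun u₀ ⟨L, hL⟩ u hu => ?_⟩
    obtain ⟨v, hv, hvK⟩ := hK _ u₀ (HJ.lipschitzWith_gradSupNorm hL)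
    rwa [hu.unique hF hv]
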